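/- Let $\{\zeta_t, t\in\mathbb Z\}$ be i.i.d. real random variables with $E\zeta_0=0$, $E\zeta_0^2=1$. A projective process is a sequence of square integrable random variables $Y_t$, measurable with respect to $\sigma\{\zeta_u: u\le t\}$, of the form $Y_t = E Y_t+\sum_{s\le t} g_{s,t}\zeta_s$ (convergence in mean square), where $g_{s,t}$ is $\sigma\{\zeta_u: s<u\le t\}$-measurable for $s<t$, $g_{t,t}$ is deterministic, and $\sum_{s\le t}E g_{s,t}^2<\infty$ for all $t$. Let $p\ge 2$ be real. There is a finite constant $C_p$, depending on $p$ alone, such that for every standardized i.i.d. sequence $\{\zeta_t\}$ with $\mu_p:=E|\zeta_0|^p<\infty$ and every projective process $\{Y_t\}$, whenever $\sum_{s\le t}(E|g_{s,t}|^p)^{2/p}<\infty$, $$E|Y_t|^p<\infty,\qquad E|Y_t|^p\le C_p\Big(|EY_t|^p+\mu_p\big(\textstyle\sum_{s\le t}(E|g_{s,t}|^p)^{2/p}\big)^{p/2}\Big).\qquad (*)$$ Let $C_p$ be any constant with this property. Let $\alpha\in\mathbb R$ and let real $\beta_1,\beta_2,\dots$ satisfy $B:=\big(\sum_{j\ge1}\beta_j^2\big)^{1/2}<\infty$.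 Let $\{r_t\}$ be a strictly stationary solution with finite second moment of the LARCH equations $$r_t=\sigma_t\zeta_t,\qquad \sigma_t=\alpha+\sum_{j=1}^\infty\beta_j r_{t-j},\qquad t\in\mathbb Z,$$ where the series converges in mean square and $\sigma_t$ is measurable with respect to $\sigma\{\zeta_u: u\le t-1\}$ up to null sets. Suppose that $\mu_p=E|\zeta_0|^p<\infty$ and $$C_p^{1/p}\,\mu_p^{1/p}\,B<1 .$$ Then, for every $t$, $E|r_t|^p=\mu_p\,E|\sigma_t|^p<\infty$. Moreover, $$\big(E|\sigma_t-\alpha|^p\big)^{2/p}\ \le\ \frac{\alpha^2\,C_p^{4/p}\mu_p^{2/p}B^2}{1-C_p^{2/p}\mu_p^{2/p}B^2}, \qquad \big(E|\sigma_t|^p\big)^{2/p}\ \le\ \frac{\alpha^2\,C_p^{2/p}}{1-C_p^{2/p}\mu_p^{2/p}B^2}.$$ -/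

import Mathlib

open MeasureTheory ProbabilityTheory Filter Topology

universe u

/-- A family of i.i.d. real random variables indexed by the integers, with mean zero and
variance one. -/
structure IsStandardizedIID {Ω : Type u} [MeasurableSpace Ω] (ζ : ℤ → Ω → ℝ) (P : Measure Ω) :
    Prop where
  measurable : ∀ t, Measurable (ζ t)
  indep : iIndepFun ζ P
  identDistrib : ∀ t, IdentDistrib (ζ t) (ζ 0) P P
  mean_zero : ∫ ω, ζ 0 ω ∂P = 0
  variance_one : ∫ ω, (ζ 0 ω) ^ 2 ∂P = 1

/-- The sigma-algebra generated by the innovations `ζ u`, `u ∈ T`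
(the trivial one if `T` is empty). -/
abbrev innovationSigma {Ω : Type u} (ζ : ℤ → Ω → ℝ) (T : Set ℤ) : MeasurableSpace Ω :=
  ⨆ u ∈ T, MeasurableSpace.comap (ζ u) inferInstance

/-- `Y` is a projective process with coefficients `g`: each `Y t` is a square integrable random
variable that depends on `ζ u`, `u ≤ t`, only, and `Y t = E (Y t) + ∑_{s ≤ t} g s t * ζ s`
with convergence in mean square.  The index `s ≤ t` is written `s = t - k`, `k = 0, 1, 2, …`. -/
structure IsProjectiveProcess {Ω : Type u} [MeasurableSpace Ω] (ζ : ℤ → Ω → ℝ) (P : Measure Ω)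
    (g : ℤ → ℤ → Ω → ℝ) (Y : ℤ → Ω → ℝ) : Prop where
  memLp : ∀ t, MemLp (Y t) 2 P
  causal : ∀ t, AEStronglyMeasurable[innovationSigma ζ (Set.Iic t)] (Y t) P
  /-- For `s = t` the interval `[s + 1, t]` is empty and this says that `g t t` is (almost surely
  equal to) a deterministic number. -/
  coeff_measurable : ∀ s t, s ≤ t →
    AEStronglyMeasurable[innovationSigma ζ (Set.Icc (s + 1) t)] (g s t) P
  coeff_memLp : ∀ s t, s ≤ t → MemLp (g s t) 2 P
  coeff_summable : ∀ t, Summable fun k : ℕ => ∫ ω, (g (t - k) t ω) ^ 2 ∂P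
  expansion : ∀ t, Tendsto
    (fun n : ℕ => eLpNorm
      (fun ω => Y t ω - ((∫ ω', Y t ω' ∂P) + ∑ k ∈ Finset.range n, g (t - k) t ω * ζ (t - k) ω))
      2 P)
    atTop (𝓝 0)

/-- `C` is an admissible constant, for the exponent `p`, in the Rosenthal type moment inequality
`E |Y t| ^ p ≤ C * (|E (Y t)| ^ p + μ_p * (∑_{s ≤ t} (E |g s t| ^ p) ^ (2 / p)) ^ (p / 2))`
for projective processes, simultaneously for all probability spaces, all standardized i.i.d.
innovations with `μ_p = E |ζ 0| ^ p < ∞`, and all projective processes for which the sum on the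
right-hand side is finite. -/
def IsRosenthalConstant (p C : ℝ) : Prop :=
  ∀ (Ω : Type u) [MeasurableSpace Ω] (P : Measure Ω) [IsProbabilityMeasure P]
    (ζ : ℤ → Ω → ℝ) (g : ℤ → ℤ → Ω → ℝ) (Y : ℤ → Ω → ℝ),
    IsStandardizedIID ζ P →
    IsProjectiveProcess ζ P g Y →
    Integrable (fun ω => |ζ 0 ω| ^ p) P →
    ∀ t : ℤ,
      (∀ k : ℕ, Integrable (fun ω => |g (t - k) t ω| ^ p) P) →
      (Summable fun k : ℕ => (∫ ω, |g (t - k) t ω| ^ p ∂P) ^ (2 / p)) →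
      Integrable (fun ω => |Y t ω| ^ p) P ∧
      ∫ ω, |Y t ω| ^ p ∂P ≤
        C * (|∫ ω, Y t ω ∂P| ^ p +
          (∫ ω, |ζ 0 ω| ^ p ∂P) *
            (∑' k : ℕ, (∫ ω, |g (t - k) t ω| ^ p ∂P) ^ (2 / p)) ^ (p / 2))

/-- `(r, σ)` is a second order strictly stationary (causal) solution of the LARCH equations
`r t = σ t * ζ t`, `σ t = α + ∑_{j ≥ 1} β j * r (t - j)`, the series converging in mean square.
The value `β 0` plays no role. -/
structure IsLarchSolution {Ω : Type u} [MeasurableSpace Ω] (ζ : ℤ → Ω → ℝ) (P : Measure Ω)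
    (α : ℝ) (β : ℕ → ℝ) (r σ : ℤ → Ω → ℝ) : Prop where
  predictable : ∀ t, AEStronglyMeasurable[innovationSigma ζ (Set.Iic (t - 1))] (σ t) P
  return_eq : ∀ t, r t =ᵐ[P] fun ω => σ t ω * ζ t ω
  volatility_eq : ∀ t, Tendsto
    (fun n : ℕ => eLpNorm
      (fun ω => σ t ω - (α + ∑ j ∈ Finset.Icc 1 n, β j * r (t - j) ω)) 2 P)
    atTop (𝓝 0)
  second_order : ∀ t, MemLp (r t) 2 P
  strictly_stationary : ∀ h : ℤ,
    IdentDistrib (fun ω (t : ℤ) => r (t + h) ω) (fun ω (t : ℤ) => r t ω) P P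

/-- `B = (∑_{j ≥ 1} β j ^ 2) ^ (1 / 2)`. -/
noncomputable def larchB (β : ℕ → ℝ) : ℝ := √(∑' j : ℕ, (β (j + 1)) ^ 2)

/-!
The moment inequality for projective processes is a statement about the martingale
`E Y + ∑_{k < n} g_{t-k,t} ζ_{t-k}`, read from time `t` into the past: the coefficient of
`ζ_{t-k}` depends on the innovations after `t - k` only.  A Taylor bound for `|x + y| ^ p`
(`abs_add_rpow_le`), whose linear term has mean zero by independence, shows that adding such a
martingale difference raises the squared `L ^ p` norm by at most a constant times the squared norm
of the difference (`rpow_integral_add_mul_le`).  Summing these increments bounds the partial sums,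
and Fatou's lemma along an almost surely convergent subsequence passes to `Y`
(`exists_isRosenthalConstant`).

A stationary solution `σ` of the LARCH equations is `α` plus a Volterra series in the innovations.
Its coefficients `α H_{t,n}`, grouped by the earliest innovation `ζ_{t-n}` that occurs
(`volterraCoeff`), obey two recursions, one splitting off the last jump and one splitting off the
first.  The second says that the partial sums of the series solve the LARCH recursion with returns
set to zero before time `t - n` (`truncatedVolatility_eq`).  Hence the mean square distance of `σ`
from these partial sums satisfies a defective renewal inequality with total mass `∑ β_j²`, and tends
to zero as soon as `∑ β_j² < 1`; this holds because an admissible constant `C` and the moment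
`μ = E |ζ_0| ^ p` are both at least one.  So `σ` and `σ - α` are projective with coefficients
`α H_{t,n}`.

By the first recursion, `H_{t,n}` is itself projective, with mean `β_n` and coefficients
`β_{n-k} H_{t,k}`.  The moment inequality gives, for `a_n = (E |H_{t,n}| ^ p) ^ (2/p)`,
`a_n ≤ C ^ (2/p) (β_n² + μ ^ (2/p) ∑_{k < n} β_{n-k}² a_k)`.  Summing over `n` yields
`∑ a_n ≤ C ^ (2/p) B² / (1 - C ^ (2/p) μ ^ (2/p) B²)`, and a last application of the moment
inequality, to `σ` and to `σ - α`, gives the two bounds.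
-/

/-! ### Elementary inequalities for powers -/

theorem abs_one_add_rpow_le {p : ℝ} (hp : 2 ≤ p) (u : ℝ) :
    |1 + u| ^ p ≤ 1 + p * u + p * 2 ^ p * (u ^ 2 + |u| ^ p) := by
  have h2p : p ≤ (2 : ℝ) ^ p := by
    have := one_add_mul_self_le_rpow_one_add (s := 1) (by norm_num) (p := p) (by linarith)
    norm_num at this
    linarith
  have hup : 0 ≤ |u| ^ p := by positivity
  -- for `|u| ≥ 1` the term `|u| ^ p` dominates; for `|u| < 1` convexity gives a quadratic bound
  rcases le_or_gt 1 |u| with hu | hu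
  · have h1 : |1 + u| ^ p ≤ 2 ^ p * |u| ^ p := by
      rw [← Real.mul_rpow (by norm_num) (abs_nonneg u)]
      refine Real.rpow_le_rpow (abs_nonneg _) ?_ (by linarith)
      calc |1 + u| ≤ |1| + |u| := abs_add_le _ _
        _ ≤ 2 * |u| := by rw [abs_one]; linarith
    have h2 : |u| ≤ |u| ^ p := by
      calc |u| = |u| ^ (1 : ℝ) := (Real.rpow_one _).symm
        _ ≤ |u| ^ p := Real.rpow_le_rpow_of_exponent_le hu (by linarith)
    have h3 : -(p * u) ≤ p * |u| ^ p := by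
      have := neg_abs_le u
      nlinarith
    have h4 : 0 ≤ p * 2 ^ p * u ^ 2 := by positivity
    nlinarith [mul_le_mul_of_nonneg_right h2p hup,
      mul_le_mul_of_nonneg_right (mul_le_mul_of_nonneg_right hp (by positivity : (0:ℝ) ≤ 2 ^ p)) hup]
  · obtain ⟨hu1, hu2⟩ := abs_lt.1 hu
    have hw : 0 < 1 + u := by linarith
    rw [abs_of_pos hw]
    -- the convex function `w ↦ w ^ p` lies above its tangent at `1 + u`
    have hconv : (1 + u) ^ p ≤ 1 + p * u * (1 + u) ^ (p - 1) := by
      have h := one_add_mul_self_le_rpow_one_add (s := (1 + u)⁻¹ - 1)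
        (by have := inv_pos.2 hw; linarith) (p := p) (by linarith)
      have hpw : 0 < (1 + u) ^ (p - 1) := Real.rpow_pos_of_pos hw _
      have hsplit : (1 + u) ^ p = (1 + u) ^ (p - 1) * (1 + u) := by
        rw [← Real.rpow_add_one hw.ne']; ring_nf
      have h' := mul_le_mul_of_nonneg_left h (Real.rpow_pos_of_pos hw p).le
      rw [add_sub_cancel, ← Real.mul_rpow hw.le (inv_pos.2 hw).le, mul_inv_cancel₀ hw.ne',
        Real.one_rpow] at h'
      have h5 : (1 + u) ^ p * (1 + u)⁻¹ = (1 + u) ^ (p - 1) := by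
        rw [hsplit]; field_simp
      nlinarith
    have hquad : u * (1 + u) ^ (p - 1) ≤ u + 2 ^ p * u ^ 2 := by
      rcases le_total 0 u with h0 | h0
      · have hc := (convexOn_rpow (p := p - 1) (by linarith)).2
          (show (1 : ℝ) ∈ Set.Ici 0 by simp) (show (2 : ℝ) ∈ Set.Ici 0 by simp)
          (by linarith) h0 (by ring : (1 - u) + u = 1)
        simp only [smul_eq_mul, Real.one_rpow] at hc
        have e : (1 - u) * 1 + u * 2 = 1 + u := by ring
        rw [e] at hc
        have hle : (2 : ℝ) ^ (p - 1) ≤ 2 ^ p :=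
          Real.rpow_le_rpow_of_exponent_le (by norm_num) (by linarith)
        nlinarith [mul_le_mul_of_nonneg_left hc h0, mul_le_mul_of_nonneg_left hle (sq_nonneg u),
          sq_nonneg u]
      · have hb := one_add_mul_self_le_rpow_one_add (s := u) hu1.le (p := p - 1) (by linarith)
        nlinarith [mul_le_mul_of_nonpos_left hb h0, mul_le_mul_of_nonneg_left h2p (sq_nonneg u),
          sq_nonneg u]
    have h6 : 0 ≤ p * 2 ^ p * |u| ^ p := by positivity
    nlinarith [mul_le_mul_of_nonneg_left hquad (by linarith : (0:ℝ) ≤ p)]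

/-- A second order Taylor bound for `z ↦ |z| ^ p`; the linear term is what a centred independent
factor kills. -/
theorem abs_add_rpow_le {p : ℝ} (hp : 2 ≤ p) (x y : ℝ) :
    |x + y| ^ p ≤ |x| ^ p + p * (|x| ^ (p - 2) * x) * y
      + p * 2 ^ p * (|x| ^ (p - 2) * y ^ 2 + |y| ^ p) := by
  rcases eq_or_ne x 0 with rfl | hx
  · have h1 : (1 : ℝ) ≤ p * 2 ^ p := by
      have : (1 : ℝ) ≤ 2 ^ p := Real.one_le_rpow (by norm_num) (by linarith)
      nlinarith
    have h2 : 0 ≤ |y| ^ p := by positivity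
    have h3 : 0 ≤ |(0 : ℝ)| ^ (p - 2) * y ^ 2 := by positivity
    have h4 : |(0 : ℝ)| ^ p = 0 := by rw [abs_zero, Real.zero_rpow (by linarith)]
    rw [h4, zero_add]
    nlinarith
  · have hx' : 0 < |x| := abs_pos.2 hx
    have h := mul_le_mul_of_nonneg_left (abs_one_add_rpow_le hp (y / x))
      (Real.rpow_pos_of_pos hx' p).le
    have hsplit : |x| ^ p = |x| ^ (p - 2) * x ^ 2 := by
      rw [← sq_abs, ← Real.rpow_natCast |x| 2, ← Real.rpow_add hx']; norm_num
    have e1 : |x| ^ p * |1 + y / x| ^ p = |x + y| ^ p := by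
      rw [← Real.mul_rpow hx'.le (abs_nonneg _), ← abs_mul]; congr 2; field_simp
    have e2 : |x| ^ p * |y / x| ^ p = |y| ^ p := by
      rw [← Real.mul_rpow hx'.le (abs_nonneg _), ← abs_mul]; congr 2; field_simp
    rw [e1] at h
    refine h.trans (le_of_eq ?_)
    have e3 : |x| ^ p * (y / x) = |x| ^ (p - 2) * x * y := by rw [hsplit]; field_simp
    have e4 : |x| ^ p * (y / x) ^ 2 = |x| ^ (p - 2) * y ^ 2 := by rw [hsplit]; field_simp
    linear_combination p * e3 + p * 2 ^ p * (e4 + e2)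

/-- With `q = p / 2`, this turns an additive bound for `p`-th moments into one for the squared
`L ^ p` norms `a` and `d`. -/
theorem rpow_add_two_mul_le {q K a d : ℝ} (hq : 1 ≤ q) (hK : 1 ≤ K) (ha : 0 ≤ a) (hd : 0 ≤ d) :
    a ^ q + K * (a ^ (q - 1) * d + d ^ q) ≤ (a + 2 * K * d) ^ q := by
  have hw : 0 ≤ 2 * K * d := by positivity
  have h1 : a ^ q + (2 * K * d) ^ q ≤ (a + 2 * K * d) ^ q := Real.add_rpow_le_rpow_add ha hw hq
  have h2 : 2 * K * d ^ q ≤ (2 * K * d) ^ q := by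
    rw [Real.mul_rpow (by positivity) hd]
    refine mul_le_mul_of_nonneg_right ?_ (by positivity)
    calc 2 * K = (2 * K) ^ (1 : ℝ) := (Real.rpow_one _).symm
      _ ≤ (2 * K) ^ q := Real.rpow_le_rpow_of_exponent_le (by linarith) hq
  have h3 : a ^ q + 2 * K * (a ^ (q - 1) * d) ≤ (a + 2 * K * d) ^ q := by
    rcases ha.eq_or_lt with rfl | ha'
    · rcases hq.eq_or_lt with rfl | hq'
      · simp
      · rw [Real.zero_rpow (by linarith), Real.zero_rpow (by linarith)]
        simp only [zero_mul, mul_zero, add_zero]; positivity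
    · have hb := one_add_mul_self_le_rpow_one_add (s := 2 * K * d / a)
        (by have : 0 ≤ 2 * K * d / a := by positivity
            linarith) hq
      have hb' := mul_le_mul_of_nonneg_left hb (Real.rpow_pos_of_pos ha' q).le
      rw [← Real.mul_rpow ha (by positivity), mul_add, mul_add, mul_one, mul_one,
        mul_div_cancel₀ _ ha'.ne'] at hb'
      refine le_trans ?_ hb'
      have e : a ^ q = a ^ (q - 1) * a := by rw [← Real.rpow_add_one ha'.ne']; ring_nf
      have e2 : a ^ q * (q * (2 * K * d / a)) = q * (2 * K * (a ^ (q - 1) * d)) := by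
        rw [e]; field_simp
      rw [e2]
      have : 0 ≤ 2 * K * (a ^ (q - 1) * d) := by positivity
      nlinarith
  linarith

theorem add_rpow_le_two_rpow_mul {q a b : ℝ} (hq : 0 ≤ q) (ha : 0 ≤ a) (hb : 0 ≤ b) :
    (a + b) ^ q ≤ 2 ^ q * (a ^ q + b ^ q) := by
  wlog hab : a ≤ b generalizing a b
  · rw [add_comm a, add_comm (a ^ q)]
    exact this hb ha (le_of_not_ge hab)
  calc (a + b) ^ q ≤ (2 * b) ^ q := Real.rpow_le_rpow (by positivity) (by linarith) hq
    _ = 2 ^ q * b ^ q := Real.mul_rpow (by norm_num) hb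
    _ ≤ _ := by
      have : 0 ≤ a ^ q := by positivity
      have h2 : (0 : ℝ) ≤ 2 ^ q := by positivity
      nlinarith

theorem rpow_div_two_rpow {p x : ℝ} (hp : p ≠ 0) (hx : 0 ≤ x) : (x ^ (2 / p)) ^ (p / 2) = x := by
  rw [← Real.rpow_mul hx, div_mul_div_cancel₀ hp, div_self two_ne_zero, Real.rpow_one]

theorem rpow_two_div_rpow {p x : ℝ} (hp : p ≠ 0) (hx : 0 ≤ x) : (x ^ (p / 2)) ^ (2 / p) = x := by
  rw [← Real.rpow_mul hx, div_mul_div_cancel₀ two_ne_zero, div_self hp, Real.rpow_one]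

/-! ### Absolute moments -/

section AbsoluteMoments

variable {Ω : Type*} [mΩ : MeasurableSpace Ω] {P : Measure Ω}

theorem memLp_ofReal_iff {p : ℝ} (hp : 0 < p) {X : Ω → ℝ} (hX : AEStronglyMeasurable X P) :
    MemLp X (ENNReal.ofReal p) P ↔ Integrable (fun ω => |X ω| ^ p) P := by
  have h := integrable_norm_rpow_iff (p := ENNReal.ofReal p) hX (by simpa using hp) (by simp)
  rw [ENNReal.toReal_ofReal hp.le] at h
  exact h.symm

theorem MeasureTheory.MemLp.integrable_abs_rpow {p : ℝ} (hp : 0 < p) {X : Ω → ℝ}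
    (hX : MemLp X (ENNReal.ofReal p) P) : Integrable (fun ω => |X ω| ^ p) P :=
  (memLp_ofReal_iff hp hX.1).1 hX

/-- Hölder's inequality for `f ^ a * g ^ b` with `a + b = 1`, degenerate exponents included. -/
theorem integrable_and_integral_rpow_mul_rpow_le {f g : Ω → ℝ} (hf : Integrable f P)
    (hg : Integrable g P) (hf0 : ∀ ω, 0 ≤ f ω) (hg0 : ∀ ω, 0 ≤ g ω) {a b : ℝ} (ha : 0 ≤ a)
    (hb : 0 ≤ b) (hab : a + b = 1) :
    Integrable (fun ω => f ω ^ a * g ω ^ b) P ∧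
      ∫ ω, f ω ^ a * g ω ^ b ∂P ≤ (∫ ω, f ω ∂P) ^ a * (∫ ω, g ω ∂P) ^ b := by
  have hI : 0 ≤ ∫ ω, f ω ∂P := integral_nonneg hf0
  have hJ : 0 ≤ ∫ ω, g ω ∂P := integral_nonneg hg0
  have key : ∫⁻ ω, ENNReal.ofReal (f ω ^ a * g ω ^ b) ∂P
      ≤ ENNReal.ofReal ((∫ ω, f ω ∂P) ^ a * (∫ ω, g ω ∂P) ^ b) := by
    have h := ENNReal.lintegral_mul_norm_pow_le (μ := P) (f := fun ω => ENNReal.ofReal (f ω))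
      (g := fun ω => ENNReal.ofReal (g ω)) hf.1.aemeasurable.ennreal_ofReal
      hg.1.aemeasurable.ennreal_ofReal ha hb hab
    rw [← ofReal_integral_eq_lintegral_ofReal hf (ae_of_all _ hf0),
      ← ofReal_integral_eq_lintegral_ofReal hg (ae_of_all _ hg0),
      ENNReal.ofReal_rpow_of_nonneg hI ha, ENNReal.ofReal_rpow_of_nonneg hJ hb,
      ← ENNReal.ofReal_mul (by positivity)] at h
    refine le_trans (le_of_eq (lintegral_congr fun ω => ?_)) h
    rw [ENNReal.ofReal_rpow_of_nonneg (hf0 ω) ha, ENNReal.ofReal_rpow_of_nonneg (hg0 ω) hb,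
      ← ENNReal.ofReal_mul (Real.rpow_nonneg (hf0 ω) a)]
  have hpos : ∀ ω, 0 ≤ f ω ^ a * g ω ^ b := fun ω =>
    mul_nonneg (Real.rpow_nonneg (hf0 ω) a) (Real.rpow_nonneg (hg0 ω) b)
  have hmeas : AEStronglyMeasurable (fun ω => f ω ^ a * g ω ^ b) P :=
    ((hf.1.aemeasurable.pow_const a).mul (hg.1.aemeasurable.pow_const b)).aestronglyMeasurable
  have hint : Integrable (fun ω => f ω ^ a * g ω ^ b) P :=
    (lintegral_ofReal_ne_top_iff_integrable hmeas (ae_of_all _ hpos)).1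
      (ne_top_of_le_ne_top ENNReal.ofReal_ne_top key)
  refine ⟨hint, ?_⟩
  rw [← ofReal_integral_eq_lintegral_ofReal hint (ae_of_all _ hpos)] at key
  exact (ENNReal.ofReal_le_ofReal_iff (by positivity)).1 key

theorem integral_sq_le_rpow [IsProbabilityMeasure P] {p : ℝ} (hp : 2 ≤ p) {X : Ω → ℝ}
    (hX : MemLp X (ENNReal.ofReal p) P) :
    ∫ ω, X ω ^ 2 ∂P ≤ (∫ ω, |X ω| ^ p ∂P) ^ (2 / p) := by
  have hp0 : 0 < p := by linarith
  have h := (integrable_and_integral_rpow_mul_rpow_le (P := P) (f := fun _ => (1 : ℝ))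
    (integrable_const 1) (hX.integrable_abs_rpow hp0) (fun _ => zero_le_one)
    (fun ω => by positivity) (a := 1 - 2 / p) (b := 2 / p)
    (by rw [sub_nonneg, div_le_one hp0]; exact hp) (by positivity) (by ring)).2
  simp only [Real.one_rpow, one_mul, integral_const, probReal_univ, smul_eq_mul] at h
  refine le_trans (le_of_eq (integral_congr_ae (ae_of_all _ fun ω => ?_))) h
  simp only
  rw [← Real.rpow_mul (abs_nonneg _), mul_div_cancel₀ _ hp0.ne', Real.rpow_two, sq_abs]

end AbsoluteMoments

/-! ### Independent multipliers -/

section Step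

variable {Ω : Type*} {m : MeasurableSpace Ω} [mΩ : MeasurableSpace Ω] {P : Measure Ω}

/-- Measurability up to null sets is enough for independence. -/
theorem indepFun_of_indep_comap {X ξ : Ω → ℝ}
    (hind : Indep m (MeasurableSpace.comap ξ inferInstance) P)
    (hX : AEStronglyMeasurable[m] X P) : IndepFun X ξ P := by
  have h : IndepFun (hX.mk X) ξ P := by
    rw [IndepFun_iff_Indep]
    exact indep_of_indep_of_le_left hind hX.stronglyMeasurable_mk.measurable.comap_le
  exact h.congr hX.ae_eq_mk.symm (ae_eq_refl ξ)

theorem ProbabilityTheory.IndepFun.integral_abs_mul_rpow {V ξ : Ω → ℝ} (h : IndepFun V ξ P)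
    (hV : AEStronglyMeasurable V P) (hξ : AEStronglyMeasurable ξ P) (p : ℝ) :
    ∫ ω, |V ω * ξ ω| ^ p ∂P = (∫ ω, |V ω| ^ p ∂P) * ∫ ω, |ξ ω| ^ p ∂P := by
  have hm : Measurable fun x : ℝ => |x| ^ p := by fun_prop
  refine Eq.trans ?_ ((h.comp hm hm).integral_mul_eq_mul_integral
    (hm.comp_aemeasurable hV.aemeasurable).aestronglyMeasurable
    (hm.comp_aemeasurable hξ.aemeasurable).aestronglyMeasurable)
  refine integral_congr_ae (ae_of_all _ fun ω => ?_)
  simp only [Pi.mul_apply, Function.comp_apply]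
  rw [abs_mul, Real.mul_rpow (abs_nonneg _) (abs_nonneg _)]

theorem ProbabilityTheory.IndepFun.memLp_mul {V ξ : Ω → ℝ} (h : IndepFun V ξ P) {p : ℝ}
    (hp : 0 < p) (hV : MemLp V (ENNReal.ofReal p) P) (hξ : MemLp ξ (ENNReal.ofReal p) P) :
    MemLp (fun ω => V ω * ξ ω) (ENNReal.ofReal p) P := by
  have hm : Measurable fun x : ℝ => |x| ^ p := by fun_prop
  refine (memLp_ofReal_iff hp (hV.1.mul hξ.1)).2 ?_
  refine ((h.comp hm hm).integrable_mul (hV.integrable_abs_rpow hp)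
    (hξ.integrable_abs_rpow hp)).congr (ae_of_all _ fun ω => ?_)
  simp only [Pi.mul_apply, Function.comp_apply]
  rw [abs_mul, Real.mul_rpow (abs_nonneg _) (abs_nonneg _)]

/-- Adding the martingale difference `V * ξ` raises the squared `L ^ p` norm by at most a constant
times the squared norm of the difference: `L ^ p` has martingale type two. -/
theorem rpow_integral_add_mul_le {p : ℝ} (hp : 2 ≤ p) (hm : m ≤ mΩ)
    {X V ξ : Ω → ℝ} (hind : Indep m (MeasurableSpace.comap ξ inferInstance) P)
    (hξ : MemLp ξ (ENNReal.ofReal p) P) (hξ0 : ∫ ω, ξ ω ∂P = 0)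
    (hXm : AEStronglyMeasurable[m] X P) (hVm : AEStronglyMeasurable[m] V P)
    (hX : MemLp X (ENNReal.ofReal p) P) (hV : MemLp V (ENNReal.ofReal p) P) :
    (∫ ω, |X ω + V ω * ξ ω| ^ p ∂P) ^ (2 / p) ≤ (∫ ω, |X ω| ^ p ∂P) ^ (2 / p) +
      2 * (p * 2 ^ p) * ((∫ ω, |ξ ω| ^ p ∂P) ^ (2 / p) * (∫ ω, |V ω| ^ p ∂P) ^ (2 / p)) := by
  have hp0 : 0 < p := by linarith
  have hVξ := indepFun_of_indep_comap hind hVm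
  have hD := hVξ.memLp_mul hp0 hV hξ
  have hD' : ∫ ω, |V ω * ξ ω| ^ p ∂P = (∫ ω, |V ω| ^ p ∂P) * ∫ ω, |ξ ω| ^ p ∂P :=
    hVξ.integral_abs_mul_rpow hV.1 hξ.1 p
  have iX := hX.integrable_abs_rpow hp0
  have iD := hD.integrable_abs_rpow hp0
  have nX : 0 ≤ ∫ ω, |X ω| ^ p ∂P := integral_nonneg fun ω => by positivity
  have nV : 0 ≤ ∫ ω, |V ω| ^ p ∂P := integral_nonneg fun ω => by positivity
  have nξ : 0 ≤ ∫ ω, |ξ ω| ^ p ∂P := integral_nonneg fun ω => by positivity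
  have nD : 0 ≤ ∫ ω, |V ω * ξ ω| ^ p ∂P := integral_nonneg fun ω => by positivity
  have cont : Continuous fun x : ℝ => |x| ^ (p - 2) * x :=
    (continuous_abs.rpow_const fun x => Or.inr (by linarith)).mul continuous_id
  -- the linear term of the Taylor bound
  have hlin : Integrable (fun ω => |X ω| ^ (p - 2) * X ω * (V ω * ξ ω)) P ∧
      ∫ ω, |X ω| ^ (p - 2) * X ω * (V ω * ξ ω) ∂P = 0 := by
    constructor
    · have h := (integrable_and_integral_rpow_mul_rpow_le iX iD (fun ω => by positivity)
        (fun ω => by positivity) (a := (p - 1) / p) (b := 1 / p)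
        (div_nonneg (by linarith) hp0.le) (by positivity) (by field_simp; ring)).1
      refine h.mono ((cont.comp_aestronglyMeasurable hX.1).mul hD.1) (ae_of_all _ fun ω => ?_)
      rw [← Real.rpow_mul (abs_nonneg _), ← Real.rpow_mul (abs_nonneg _),
        mul_div_cancel₀ _ hp0.ne', mul_div_cancel₀ _ hp0.ne', Real.rpow_one, Real.norm_eq_abs,
        Real.norm_eq_abs, abs_mul, abs_mul (|X ω| ^ (p - 2)),
        abs_of_nonneg (by positivity : 0 ≤ |X ω| ^ (p - 2)),
        abs_of_nonneg (by positivity : 0 ≤ |X ω| ^ (p - 1) * |V ω * ξ ω|)]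
      refine mul_le_mul_of_nonneg_right (le_of_eq ?_) (abs_nonneg _)
      rcases eq_or_ne (X ω) 0 with h0 | h0
      · rw [h0, abs_zero, mul_zero, Real.zero_rpow (by linarith)]
      · rw [← Real.rpow_add_one (abs_ne_zero.2 h0)]; ring_nf
    · have hW : AEStronglyMeasurable[m] (fun ω => |X ω| ^ (p - 2) * X ω * V ω) P :=
        (cont.comp_aestronglyMeasurable hXm).mul hVm
      have h := (indepFun_of_indep_comap hind hW).integral_mul_eq_mul_integral (hW.mono hm) hξ.1
      rw [hξ0, mul_zero] at h
      rw [← h]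
      refine integral_congr_ae (ae_of_all _ fun ω => ?_)
      simp only [Pi.mul_apply]
      ring
  have hquad : Integrable (fun ω => |X ω| ^ (p - 2) * (V ω * ξ ω) ^ 2) P ∧
      ∫ ω, |X ω| ^ (p - 2) * (V ω * ξ ω) ^ 2 ∂P ≤
        (∫ ω, |X ω| ^ p ∂P) ^ ((p - 2) / p) * (∫ ω, |V ω * ξ ω| ^ p ∂P) ^ (2 / p) := by
    have h := integrable_and_integral_rpow_mul_rpow_le iX iD (fun ω => by positivity)
        (fun ω => by positivity) (a := (p - 2) / p) (b := 2 / p)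
        (div_nonneg (by linarith) hp0.le) (by positivity) (by field_simp; ring)
    have e : (fun ω => (|X ω| ^ p) ^ ((p - 2) / p) * (|V ω * ξ ω| ^ p) ^ (2 / p))
        = fun ω => |X ω| ^ (p - 2) * (V ω * ξ ω) ^ 2 := by
      funext ω
      rw [← Real.rpow_mul (abs_nonneg _), ← Real.rpow_mul (abs_nonneg _),
        mul_div_cancel₀ _ hp0.ne', mul_div_cancel₀ _ hp0.ne', Real.rpow_two, sq_abs]
    rwa [e] at h
  have hS := (hX.add hD).integrable_abs_rpow hp0
  have hmain : ∫ ω, |X ω + V ω * ξ ω| ^ p ∂P ≤ ∫ ω, |X ω| ^ p ∂P + p * 2 ^ p *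
      ((∫ ω, |X ω| ^ p ∂P) ^ ((p - 2) / p) * (∫ ω, |V ω * ξ ω| ^ p ∂P) ^ (2 / p)
        + ∫ ω, |V ω * ξ ω| ^ p ∂P) := by
    have h := integral_mono hS (((iX.add (hlin.1.const_mul p)).add
      ((hquad.1.add iD).const_mul (p * 2 ^ p)))) (fun ω => by
        have := abs_add_rpow_le hp (X ω) (V ω * ξ ω)
        simp only [Pi.add_apply]
        linarith)
    rw [integral_add' (iX.add (hlin.1.const_mul p)) ((hquad.1.add iD).const_mul (p * 2 ^ p)),
      integral_add' iX (hlin.1.const_mul p), integral_const_mul, integral_const_mul,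
      integral_add' hquad.1 iD, hlin.2, mul_zero, add_zero] at h
    refine h.trans ?_
    gcongr
    exact hquad.2
  set a := (∫ ω, |X ω| ^ p ∂P) ^ (2 / p) with ha
  set d := (∫ ω, |V ω * ξ ω| ^ p ∂P) ^ (2 / p) with hd
  have ha0 : 0 ≤ a := by positivity
  have hd0 : 0 ≤ d := by positivity
  have ea : ∫ ω, |X ω| ^ p ∂P = a ^ (p / 2) := (rpow_div_two_rpow hp0.ne' nX).symm
  have ed : ∫ ω, |V ω * ξ ω| ^ p ∂P = d ^ (p / 2) := (rpow_div_two_rpow hp0.ne' nD).symm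
  have hK : (1 : ℝ) ≤ p * 2 ^ p := by
    have : (1 : ℝ) ≤ 2 ^ p := Real.one_le_rpow (by norm_num) hp0.le
    nlinarith
  rw [ea, ed, ← Real.rpow_mul ha0, show p / 2 * ((p - 2) / p) = p / 2 - 1 by field_simp] at hmain
  have h := hmain.trans (rpow_add_two_mul_le (by linarith : 1 ≤ p / 2) hK ha0 hd0)
  have h2 := Real.rpow_le_rpow (integral_nonneg fun ω => by positivity) h
    (by positivity : 0 ≤ 2 / p)
  rw [rpow_two_div_rpow hp0.ne' (by positivity)] at h2
  rwa [← Real.mul_rpow nξ nV, mul_comm (∫ ω, |ξ ω| ^ p ∂P), ← hD']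

/-- Pythagoras' theorem for a martingale difference `V * ξ`. -/
theorem integral_add_mul_sq (hm : m ≤ mΩ)
    {X V ξ : Ω → ℝ} (hind : Indep m (MeasurableSpace.comap ξ inferInstance) P)
    (hξ : MemLp ξ 2 P) (hξ0 : ∫ ω, ξ ω ∂P = 0) (hξ1 : ∫ ω, ξ ω ^ 2 ∂P = 1)
    (hXm : AEStronglyMeasurable[m] X P) (hVm : AEStronglyMeasurable[m] V P)
    (hX : MemLp X 2 P) (hV : MemLp V 2 P) :
    ∫ ω, (X ω + V ω * ξ ω) ^ 2 ∂P = ∫ ω, X ω ^ 2 ∂P + ∫ ω, V ω ^ 2 ∂P := by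
  have e2 : (2 : ENNReal) = ENNReal.ofReal 2 := by simp
  have hVξ := indepFun_of_indep_comap hind hVm
  have hD : MemLp (fun ω => V ω * ξ ω) 2 P := by
    rw [e2] at hV hξ ⊢
    exact hVξ.memLp_mul two_pos hV hξ
  have hD' : ∫ ω, (V ω * ξ ω) ^ 2 ∂P = ∫ ω, V ω ^ 2 ∂P := by
    have h := hVξ.integral_abs_mul_rpow hV.1 hξ.1 2
    simpa only [Real.rpow_two, sq_abs, hξ1, mul_one] using h
  have hlin : ∫ ω, X ω * (V ω * ξ ω) ∂P = 0 := by
    have hW : AEStronglyMeasurable[m] (fun ω => X ω * V ω) P := hXm.mul hVm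
    have h := (indepFun_of_indep_comap hind hW).integral_mul_eq_mul_integral (hW.mono hm) hξ.1
    rw [hξ0, mul_zero] at h
    rw [← h]
    refine integral_congr_ae (ae_of_all _ fun ω => ?_)
    simp only [Pi.mul_apply]
    ring
  have iXD : Integrable (fun ω => X ω * (V ω * ξ ω)) P := hX.integrable_mul hD
  calc ∫ ω, (X ω + V ω * ξ ω) ^ 2 ∂P
      = ∫ ω, (X ω ^ 2 + 2 * (X ω * (V ω * ξ ω)) + (V ω * ξ ω) ^ 2) ∂P :=
        integral_congr_ae (ae_of_all _ fun ω => by ring)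
    _ = ∫ ω, X ω ^ 2 ∂P + ∫ ω, V ω ^ 2 ∂P := by
        have iL : Integrable (fun ω => X ω ^ 2 + 2 * (X ω * (V ω * ξ ω))) P :=
          hX.integrable_sq.add (iXD.const_mul 2)
        rw [integral_add iL hD.integrable_sq,
          integral_add hX.integrable_sq (iXD.const_mul 2), integral_const_mul, hlin, hD', mul_zero,
          add_zero]

/-- Moment bounds pass to limits in mean square (Fatou's lemma along an almost surely convergent
subsequence). -/
theorem integrable_and_integral_rpow_le_of_tendsto {p c : ℝ} (hp : 0 < p) {Y : Ω → ℝ}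
    {M : ℕ → Ω → ℝ} (hY : AEStronglyMeasurable Y P) (hM : ∀ n, MemLp (M n) (ENNReal.ofReal p) P)
    (hMc : ∀ n, ∫ ω, |M n ω| ^ p ∂P ≤ c)
    (hlim : Tendsto (fun n => eLpNorm (fun ω => Y ω - M n ω) 2 P) atTop (𝓝 0)) :
    Integrable (fun ω => |Y ω| ^ p) P ∧ ∫ ω, |Y ω| ^ p ∂P ≤ c := by
  have hlim' : Tendsto (fun n => eLpNorm (M n - Y) 2 P) atTop (𝓝 0) := by
    refine hlim.congr fun n => ?_
    rw [eLpNorm_sub_comm]; rfl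
  -- mean square convergence gives almost sure convergence along a subsequence
  obtain ⟨ns, -, hns⟩ := (tendstoInMeasure_of_tendsto_eLpNorm two_ne_zero (fun n => (hM n).1) hY
    hlim').exists_seq_tendsto_ae
  have hc : 0 ≤ c := (integral_nonneg fun ω => by positivity).trans (hMc 0)
  have h0 : ∀ f : Ω → ℝ, ∀ ω, 0 ≤ |f ω| ^ p := fun f ω => by positivity
  have key : ∫⁻ ω, ENNReal.ofReal (|Y ω| ^ p) ∂P ≤ ENNReal.ofReal c := by
    calc ∫⁻ ω, ENNReal.ofReal (|Y ω| ^ p) ∂P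
        ≤ ∫⁻ ω, liminf (fun n => ENNReal.ofReal (|M (ns n) ω| ^ p)) atTop ∂P := by
          refine lintegral_mono_ae ?_
          filter_upwards [hns] with ω hω
          have : Tendsto (fun n => ENNReal.ofReal (|M (ns n) ω| ^ p)) atTop
              (𝓝 (ENNReal.ofReal (|Y ω| ^ p))) :=
            (ENNReal.continuous_ofReal.tendsto _).comp (hω.abs.rpow_const (Or.inr hp.le))
          exact this.liminf_eq.ge
      _ ≤ liminf (fun n => ∫⁻ ω, ENNReal.ofReal (|M (ns n) ω| ^ p) ∂P) atTop :=
          lintegral_liminf_le' fun n =>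
            ((hM (ns n)).integrable_abs_rpow hp).1.aemeasurable.ennreal_ofReal
      _ ≤ liminf (fun _ : ℕ => ENNReal.ofReal c) atTop := by
          refine liminf_le_liminf (Eventually.of_forall fun n => ?_)
          rw [← ofReal_integral_eq_lintegral_ofReal ((hM (ns n)).integrable_abs_rpow hp)
            (ae_of_all _ (h0 _))]
          exact ENNReal.ofReal_le_ofReal (hMc _)
      _ = ENNReal.ofReal c := liminf_const _
  have hint : Integrable (fun ω => |Y ω| ^ p) P :=
    (lintegral_ofReal_ne_top_iff_integrable
      (hY.aemeasurable.abs.pow_const p).aestronglyMeasurable (ae_of_all _ (h0 Y))).1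
      (ne_top_of_le_ne_top ENNReal.ofReal_ne_top key)
  refine ⟨hint, ?_⟩
  rw [← ofReal_integral_eq_lintegral_ofReal hint (ae_of_all _ (h0 Y))] at key
  exact (ENNReal.ofReal_le_ofReal_iff hc).1 key

theorem integral_eq_of_tendsto_eLpNorm [IsProbabilityMeasure P] {c : ℝ} {Y : Ω → ℝ}
    {M : ℕ → Ω → ℝ} (hY : MemLp Y 2 P) (hM : ∀ n, MemLp (M n) 2 P)
    (hMc : ∀ n, ∫ ω, M n ω ∂P = c)
    (hlim : Tendsto (fun n => eLpNorm (fun ω => Y ω - M n ω) 2 P) atTop (𝓝 0)) :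
    ∫ ω, Y ω ∂P = c := by
  have h1 : Tendsto (fun n => eLpNorm (M n - Y) 1 P) atTop (𝓝 0) := by
    refine tendsto_of_tendsto_of_tendsto_of_le_of_le tendsto_const_nhds hlim (fun _ => zero_le)
      fun n => ?_
    have : eLpNorm (M n - Y) 1 P ≤ eLpNorm (M n - Y) 2 P :=
      eLpNorm_le_eLpNorm_of_exponent_le one_le_two ((hM n).1.sub hY.1)
    rw [eLpNorm_sub_comm (M n) Y 2 P] at this
    exact this
  have h2 := tendsto_integral_of_L1' Y hY.1
    (Eventually.of_forall fun n => (hM n).integrable one_le_two) h1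
  simp only [hMc] at h2
  exact tendsto_nhds_unique h2 tendsto_const_nhds |>.symm ▸ rfl

end Step

/-! ### Innovations -/

section Innovations

variable {Ω : Type*} {ζ : ℤ → Ω → ℝ}

theorem innovationSigma_mono {S T : Set ℤ} (h : S ⊆ T) :
    innovationSigma ζ S ≤ innovationSigma ζ T :=
  biSup_mono h

theorem measurable_innovationSigma {T : Set ℤ} {u : ℤ} (hu : u ∈ T) :
    Measurable[innovationSigma ζ T] (ζ u) :=
  (comap_measurable (ζ u)).mono (le_biSup (fun u => MeasurableSpace.comap (ζ u) inferInstance) hu)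
    le_rfl

namespace IsStandardizedIID

variable [mΩ : MeasurableSpace Ω] {P : Measure Ω}

theorem innovationSigma_le (h : IsStandardizedIID ζ P) (T : Set ℤ) : innovationSigma ζ T ≤ mΩ :=
  iSup₂_le fun u _ => (h.measurable u).comap_le

theorem indep_innovationSigma (h : IsStandardizedIID ζ P) {T : Set ℤ} {u : ℤ} (hu : u ∉ T) :
    Indep (innovationSigma ζ T) (MeasurableSpace.comap (ζ u) inferInstance) P := by
  have := indep_iSup_of_disjoint (fun i => (h.measurable i).comap_le) h.indep.iIndep
    (S := T) (T := {u}) (Set.disjoint_singleton_right.2 hu)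
  simpa only [Set.mem_singleton_iff, iSup_iSup_eq_left] using this

theorem integral_eq_zero (h : IsStandardizedIID ζ P) (u : ℤ) : ∫ ω, ζ u ω ∂P = 0 :=
  (h.identDistrib u).integral_eq.trans h.mean_zero

theorem integral_sq (h : IsStandardizedIID ζ P) (u : ℤ) : ∫ ω, ζ u ω ^ 2 ∂P = 1 :=
  ((h.identDistrib u).comp (u := fun x : ℝ => x ^ 2) (by fun_prop)).integral_eq.trans
    h.variance_one

theorem integral_abs_rpow (h : IsStandardizedIID ζ P) (p : ℝ) (u : ℤ) :
    ∫ ω, |ζ u ω| ^ p ∂P = ∫ ω, |ζ 0 ω| ^ p ∂P :=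
  ((h.identDistrib u).comp (u := fun x : ℝ => |x| ^ p) (by fun_prop)).integral_eq

theorem memLp (h : IsStandardizedIID ζ P) {p : ℝ} (hp : 0 < p)
    (hζ : Integrable (fun ω => |ζ 0 ω| ^ p) P) (u : ℤ) : MemLp (ζ u) (ENNReal.ofReal p) P := by
  rw [memLp_ofReal_iff hp (h.measurable u).aestronglyMeasurable]
  exact ((h.identDistrib u).comp (u := fun x : ℝ => |x| ^ p) (by fun_prop)).integrable_iff.2 hζ

theorem memLp_two (h : IsStandardizedIID ζ P) (u : ℤ) : MemLp (ζ u) 2 P := by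
  refine (memLp_two_iff_integrable_sq (h.measurable u).aestronglyMeasurable).2 ?_
  -- the Bochner integral of a function that is not integrable is `0`, not `1`
  by_contra hcon
  have := h.integral_sq u
  rw [integral_undef hcon] at this
  exact zero_ne_one this

theorem one_le_moment [IsProbabilityMeasure P] (h : IsStandardizedIID ζ P) {p : ℝ} (hp : 2 ≤ p)
    (hζ : Integrable (fun ω => |ζ 0 ω| ^ p) P) : 1 ≤ ∫ ω, |ζ 0 ω| ^ p ∂P := by
  have hp0 : 0 < p := by linarith
  have h1 := integral_sq_le_rpow hp (h.memLp hp0 hζ 0)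
  rw [h.integral_sq 0] at h1
  have n : 0 ≤ ∫ ω, |ζ 0 ω| ^ p ∂P := integral_nonneg fun ω => by positivity
  have h2 := Real.rpow_le_rpow zero_le_one h1 (by positivity : 0 ≤ p / 2)
  rwa [Real.one_rpow, rpow_div_two_rpow hp0.ne' n] at h2

end IsStandardizedIID

end Innovations

/-! ### Sums of martingale differences with independent multipliers -/

section Scheme

variable {Ω : Type*} [mΩ : MeasurableSpace Ω] {P : Measure Ω} {F : ℕ → MeasurableSpace Ω}
  {ξ : ℕ → Ω → ℝ}

/-- `ξ` is a sequence of centred variables adapted to the filtration `F` with a shift, such that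
`ξ n` is independent of `F n`.  Time may run in either direction: for the projective expansion the
steps `n` go back into the past. -/
structure IsInnovationScheme (F : ℕ → MeasurableSpace Ω) (ξ : ℕ → Ω → ℝ) (P : Measure Ω) :
    Prop where
  mono : Monotone F
  le : ∀ n, F n ≤ mΩ
  measurable : ∀ n, Measurable[F (n + 1)] (ξ n)
  indep : ∀ n, Indep (F n) (MeasurableSpace.comap (ξ n) inferInstance) P
  mean_zero : ∀ n, ∫ ω, ξ n ω ∂P = 0

namespace IsInnovationScheme

theorem aestronglyMeasurable_sum (h : IsInnovationScheme F ξ P) (c : ℝ) {G : ℕ → Ω → ℝ}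
    (hG : ∀ n, AEStronglyMeasurable[F n] (G n) P) (n : ℕ) :
    AEStronglyMeasurable[F n] (fun ω => c + ∑ k ∈ Finset.range n, G k ω * ξ k ω) P := by
  induction n with
  | zero => simpa using aestronglyMeasurable_const
  | succ n ih =>
    have h1 : AEStronglyMeasurable[F (n + 1)] (fun ω => G n ω * ξ n ω) P :=
      ((hG n).mono (h.mono n.le_succ)).mul (h.measurable n).stronglyMeasurable.aestronglyMeasurable
    refine ((ih.mono (h.mono n.le_succ)).add h1).congr (ae_of_all _ fun ω => ?_)
    simp only [Pi.add_apply, Finset.sum_range_succ, add_assoc]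

theorem memLp_mul (h : IsInnovationScheme F ξ P) {p : ℝ} (hp : 0 < p) {G : ℕ → Ω → ℝ}
    (hξ : ∀ n, MemLp (ξ n) (ENNReal.ofReal p) P)
    (hG : ∀ n, AEStronglyMeasurable[F n] (G n) P) (hGp : ∀ n, MemLp (G n) (ENNReal.ofReal p) P)
    (n : ℕ) : MemLp (fun ω => G n ω * ξ n ω) (ENNReal.ofReal p) P :=
  (indepFun_of_indep_comap (h.indep n) (hG n)).memLp_mul hp (hGp n) (hξ n)

variable [IsProbabilityMeasure P]

theorem memLp_sum (h : IsInnovationScheme F ξ P) {p : ℝ} (hp : 0 < p) (c : ℝ) {G : ℕ → Ω → ℝ}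
    (hξ : ∀ n, MemLp (ξ n) (ENNReal.ofReal p) P)
    (hG : ∀ n, AEStronglyMeasurable[F n] (G n) P) (hGp : ∀ n, MemLp (G n) (ENNReal.ofReal p) P)
    (n : ℕ) :
    MemLp (fun ω => c + ∑ k ∈ Finset.range n, G k ω * ξ k ω) (ENNReal.ofReal p) P :=
  (memLp_const c).add (memLp_finsetSum _ fun k _ => h.memLp_mul hp hξ hG hGp k)

/-- Up to a constant, the squared `L ^ p` norm of the sum is at most the sum of the squared
`L ^ p` norms of the martingale differences. -/
theorem rpow_integral_sum_le (h : IsInnovationScheme F ξ P) {p : ℝ} (hp : 2 ≤ p) (c : ℝ)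
    {G : ℕ → Ω → ℝ} (hξ : ∀ n, MemLp (ξ n) (ENNReal.ofReal p) P)
    (hG : ∀ n, AEStronglyMeasurable[F n] (G n) P) (hGp : ∀ n, MemLp (G n) (ENNReal.ofReal p) P)
    (n : ℕ) :
    (∫ ω, |c + ∑ k ∈ Finset.range n, G k ω * ξ k ω| ^ p ∂P) ^ (2 / p) ≤ c ^ 2 +
      2 * (p * 2 ^ p) * ∑ k ∈ Finset.range n,
        (∫ ω, |ξ k ω| ^ p ∂P) ^ (2 / p) * (∫ ω, |G k ω| ^ p ∂P) ^ (2 / p) := by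
  have hp0 : 0 < p := by linarith
  induction n with
  | zero =>
    simp only [Finset.range_zero, Finset.sum_empty, add_zero, integral_const, probReal_univ,
      one_smul, mul_zero]
    rw [← Real.rpow_mul (abs_nonneg _), mul_div_cancel₀ _ hp0.ne', Real.rpow_two, sq_abs]
  | succ n ih =>
    have hstep := rpow_integral_add_mul_le hp (h.le n) (h.indep n) (hξ n) (h.mean_zero n)
      (h.aestronglyMeasurable_sum c hG n) (hG n) (h.memLp_sum hp0 c hξ hG hGp n) (hGp n)
    simp only [Finset.sum_range_succ, ← add_assoc]
    linarith

theorem integral_sq_sum (h : IsInnovationScheme F ξ P) (c : ℝ)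
    {G : ℕ → Ω → ℝ} (hξ : ∀ n, MemLp (ξ n) 2 P) (hξ1 : ∀ n, ∫ ω, ξ n ω ^ 2 ∂P = 1)
    (hG : ∀ n, AEStronglyMeasurable[F n] (G n) P) (hG2 : ∀ n, MemLp (G n) 2 P) (n : ℕ) :
    ∫ ω, (c + ∑ k ∈ Finset.range n, G k ω * ξ k ω) ^ 2 ∂P =
      c ^ 2 + ∑ k ∈ Finset.range n, ∫ ω, G k ω ^ 2 ∂P := by
  have e2 : (2 : ENNReal) = ENNReal.ofReal 2 := by simp
  induction n with
  | zero => simp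
  | succ n ih =>
    have hS : MemLp (fun ω => c + ∑ k ∈ Finset.range n, G k ω * ξ k ω) 2 P := by
      rw [e2] at hξ hG2 ⊢
      exact h.memLp_sum two_pos c hξ hG hG2 n
    have hstep := integral_add_mul_sq (h.le n) (h.indep n) (hξ n) (h.mean_zero n) (hξ1 n)
      (h.aestronglyMeasurable_sum c hG n) (hG n) hS (hG2 n)
    simp only [Finset.sum_range_succ, ← add_assoc]
    rw [hstep, ih]

theorem integral_sum (h : IsInnovationScheme F ξ P) (c : ℝ)
    {G : ℕ → Ω → ℝ} (hξ : ∀ n, MemLp (ξ n) 2 P)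
    (hG : ∀ n, AEStronglyMeasurable[F n] (G n) P) (hG2 : ∀ n, MemLp (G n) 2 P) (n : ℕ) :
    ∫ ω, (c + ∑ k ∈ Finset.range n, G k ω * ξ k ω) ∂P = c := by
  have hD : ∀ k, Integrable (fun ω => G k ω * ξ k ω) P := fun k => (hG2 k).integrable_mul (hξ k)
  rw [integral_add (integrable_const c) (integrable_finsetSum _ fun k _ => hD k),
    integral_finsetSum _ fun k _ => hD k, integral_const, probReal_univ, one_smul,
    Finset.sum_eq_zero, add_zero]
  intro k _
  have := (indepFun_of_indep_comap (h.indep k) (hG k)).integral_mul_eq_mul_integral (hG2 k).1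
    (hξ k).1
  rwa [h.mean_zero k, mul_zero] at this

end IsInnovationScheme

/-- Innovations taken from time `t` into the past. -/
theorem IsStandardizedIID.pastScheme {ζ : ℤ → Ω → ℝ} (h : IsStandardizedIID ζ P) (t : ℤ) :
    IsInnovationScheme (fun n : ℕ => innovationSigma ζ (Set.Icc (t - n + 1) t))
      (fun n : ℕ => ζ (t - n)) P where
  mono := fun i j hij => innovationSigma_mono (Set.Icc_subset_Icc (by omega) le_rfl)
  le := fun n => h.innovationSigma_le _
  measurable := fun n => measurable_innovationSigma (by simp)
  indep := fun n => h.indep_innovationSigma (by simp)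
  mean_zero := fun n => h.integral_eq_zero _

/-- Innovations taken from time `a` into the future. -/
theorem IsStandardizedIID.futureScheme {ζ : ℤ → Ω → ℝ} (h : IsStandardizedIID ζ P) (a : ℤ) :
    IsInnovationScheme (fun n : ℕ => innovationSigma ζ (Set.Iic (a + n - 1)))
      (fun n : ℕ => ζ (a + n)) P where
  mono := fun i j hij => innovationSigma_mono (Set.Iic_subset_Iic.2 (by omega))
  le := fun n => h.innovationSigma_le _
  measurable := fun n => measurable_innovationSigma (by simp)
  indep := fun n => h.indep_innovationSigma (by simp)
  mean_zero := fun n => h.integral_eq_zero _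

end Scheme

/-! ### The Rosenthal type inequality -/

theorem MeasureTheory.MemLp.two_of_ofReal {Ω : Type*} [MeasurableSpace Ω] {P : Measure Ω}
    [IsProbabilityMeasure P] {p : ℝ} (hp : 2 ≤ p) {X : Ω → ℝ}
    (hX : MemLp X (ENNReal.ofReal p) P) : MemLp X 2 P :=
  hX.mono_exponent (by simpa using ENNReal.ofReal_le_ofReal hp)

theorem exists_isRosenthalConstant {p : ℝ} (hp : 2 ≤ p) : ∃ C, IsRosenthalConstant.{u} p C := by
  have hp0 : 0 < p := by linarith
  set K : ℝ := 2 * (p * 2 ^ p) with hK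
  have hK1 : 1 ≤ K := by
    have : (1 : ℝ) ≤ 2 ^ p := Real.one_le_rpow (by norm_num) hp0.le
    nlinarith
  refine ⟨2 ^ (p / 2) * K ^ (p / 2), ?_⟩
  intro Ω _ P _ ζ g Y hζ hY hμ t hgp hsum
  set μ : ℝ := ∫ ω, |ζ 0 ω| ^ p ∂P with hμdef
  have hμ0 : 0 ≤ μ := integral_nonneg fun ω => by positivity
  set c : ℝ := ∫ ω, Y t ω ∂P with hc
  set A : ℝ := ∑' k : ℕ, (∫ ω, |g (t - k) t ω| ^ p ∂P) ^ (2 / p) with hA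
  have hterm : ∀ k : ℕ, 0 ≤ (∫ ω, |g (t - k) t ω| ^ p ∂P) ^ (2 / p) := fun k =>
    Real.rpow_nonneg (integral_nonneg fun ω => by positivity) _
  have hA0 : 0 ≤ A := tsum_nonneg hterm
  have hsch := hζ.pastScheme t
  have hξ : ∀ n : ℕ, MemLp (ζ (t - n)) (ENNReal.ofReal p) P := fun n => hζ.memLp hp0 hμ _
  have hG : ∀ n : ℕ, AEStronglyMeasurable[innovationSigma ζ (Set.Icc (t - n + 1) t)]
      (g (t - n) t) P := fun n => hY.coeff_measurable _ _ (by omega)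
  have hGp : ∀ n : ℕ, MemLp (g (t - n) t) (ENNReal.ofReal p) P := fun n =>
    (memLp_ofReal_iff hp0 (hY.coeff_memLp _ _ (by omega)).1).2 (hgp n)
  have hbound : ∀ n : ℕ,
      ∫ ω, |c + ∑ k ∈ Finset.range n, g (t - k) t ω * ζ (t - k) ω| ^ p ∂P ≤
        2 ^ (p / 2) * K ^ (p / 2) * (|c| ^ p + μ * A ^ (p / 2)) := by
    intro n
    have h1 := hsch.rpow_integral_sum_le hp c hξ hG hGp n
    simp only [hζ.integral_abs_rpow, ← Finset.mul_sum] at h1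
    have h2 : (∫ ω, |c + ∑ k ∈ Finset.range n, g (t - k) t ω * ζ (t - k) ω| ^ p ∂P) ^ (2 / p) ≤
        c ^ 2 + K * (μ ^ (2 / p) * A) := by
      refine h1.trans ?_
      gcongr
      exact hsum.sum_le_tsum _ fun k _ => hterm k
    have n0 : 0 ≤ ∫ ω, |c + ∑ k ∈ Finset.range n, g (t - k) t ω * ζ (t - k) ω| ^ p ∂P :=
      integral_nonneg fun ω => by positivity
    have h3 := Real.rpow_le_rpow (by positivity) h2 (by positivity : 0 ≤ p / 2)
    rw [rpow_div_two_rpow hp0.ne' n0] at h3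
    refine h3.trans ((add_rpow_le_two_rpow_mul (by positivity) (by positivity)
      (by positivity)).trans ?_)
    rw [mul_assoc (2 ^ (p / 2))]
    refine mul_le_mul_of_nonneg_left ?_ (by positivity)
    rw [Real.mul_rpow (by positivity) (by positivity), Real.mul_rpow (by positivity) hA0,
      rpow_div_two_rpow hp0.ne' hμ0, ← sq_abs, ← Real.rpow_two, ← Real.rpow_mul (abs_nonneg _),
      mul_div_cancel₀ _ two_ne_zero]
    have h4 : 1 ≤ K ^ (p / 2) := Real.one_le_rpow hK1 (by positivity)
    have h5 : 0 ≤ |c| ^ p := by positivity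
    nlinarith
  exact integrable_and_integral_rpow_le_of_tendsto hp0 (hY.memLp t).1
    (fun n => hsch.memLp_sum hp0 c hξ hG hGp n) hbound (hY.expansion t)

/-- The moment inequality for one random variable with a projective expansion: it is embedded into
a projective process that vanishes at all other times. -/
theorem IsRosenthalConstant.moment_le {p C : ℝ} (hp : 2 ≤ p) (hC : IsRosenthalConstant.{u} p C)
    {Ω : Type u} [MeasurableSpace Ω] {P : Measure Ω} [IsProbabilityMeasure P] {ζ : ℤ → Ω → ℝ}
    (hζ : IsStandardizedIID ζ P) (hμ : Integrable (fun ω => |ζ 0 ω| ^ p) P) {t : ℤ} {Y : Ω → ℝ}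
    {G : ℕ → Ω → ℝ} (hY : MemLp Y 2 P)
    (hYm : AEStronglyMeasurable[innovationSigma ζ (Set.Iic t)] Y P)
    (hG : ∀ k : ℕ, AEStronglyMeasurable[innovationSigma ζ (Set.Icc (t - k + 1) t)] (G k) P)
    (hGp : ∀ k, MemLp (G k) (ENNReal.ofReal p) P)
    (hsum : Summable fun k => (∫ ω, |G k ω| ^ p ∂P) ^ (2 / p))
    (hlim : Tendsto (fun n : ℕ => eLpNorm (fun ω => Y ω - ((∫ ω', Y ω' ∂P) +
      ∑ k ∈ Finset.range n, G k ω * ζ (t - k) ω)) 2 P) atTop (𝓝 0)) :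
    Integrable (fun ω => |Y ω| ^ p) P ∧
      ∫ ω, |Y ω| ^ p ∂P ≤ C * (|∫ ω, Y ω ∂P| ^ p + (∫ ω, |ζ 0 ω| ^ p ∂P) *
        (∑' k, (∫ ω, |G k ω| ^ p ∂P) ^ (2 / p)) ^ (p / 2)) := by
  have hp0 : 0 < p := by linarith
  let g : ℤ → ℤ → Ω → ℝ := fun s t' => if t' = t then G (t - s).toNat else 0
  let Y' : ℤ → Ω → ℝ := fun t' => if t' = t then Y else 0
  have hgt : ∀ k : ℕ, g (t - k) t = G k := fun k => by simp [g]
  have hg0 : ∀ s t', t' ≠ t → g s t' = 0 := fun s t' h => by simp [g, h]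
  have hYt : Y' t = Y := by simp [Y']
  have hY0 : ∀ t', t' ≠ t → Y' t' = 0 := fun t' h => by simp [Y', h]
  have hs : ∀ s, s ≤ t → ∃ k : ℕ, s = t - k := fun s h => ⟨(t - s).toNat, by omega⟩
  have hproj : IsProjectiveProcess ζ P g Y' := by
    refine ⟨fun t' => ?_, fun t' => ?_, fun s t' hst => ?_, fun s t' hst => ?_, fun t' => ?_,
      fun t' => ?_⟩ <;> rcases eq_or_ne t' t with rfl | ht
    · rwa [hYt]
    · rw [hY0 _ ht]; exact MemLp.zero
    · rwa [hYt]
    · rw [hY0 _ ht]; exact aestronglyMeasurable_zero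
    · obtain ⟨k, rfl⟩ := hs s hst
      rw [hgt]; exact hG k
    · rw [hg0 _ _ ht]; exact aestronglyMeasurable_zero
    · obtain ⟨k, rfl⟩ := hs s hst
      rw [hgt]; exact (hGp k).two_of_ofReal hp
    · rw [hg0 _ _ ht]; exact MemLp.zero
    · simp only [hgt]
      exact Summable.of_nonneg_of_le (fun k => integral_nonneg fun ω => sq_nonneg _)
        (fun k => integral_sq_le_rpow hp (hGp k)) hsum
    · simp [hg0 _ _ ht]
    · simpa only [hgt, hYt] using hlim
    · simp [hg0 _ _ ht, hY0 _ ht]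
  have := hC Ω P ζ g Y' hζ hproj hμ t (fun k => by
    rw [hgt]; exact (hGp k).integrable_abs_rpow hp0) (by simpa only [hgt] using hsum)
  simpa only [hgt, hYt] using this

/-- The constant process `1`, with zero coefficients, forces `1 ≤ C`. -/
theorem IsRosenthalConstant.one_le {p C : ℝ} (hp : 2 ≤ p) (hC : IsRosenthalConstant.{u} p C)
    {Ω : Type u} [MeasurableSpace Ω] {P : Measure Ω} [IsProbabilityMeasure P] {ζ : ℤ → Ω → ℝ}
    (hζ : IsStandardizedIID ζ P) (hμ : Integrable (fun ω => |ζ 0 ω| ^ p) P) : 1 ≤ C := by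
  have hp0 : 0 < p := by linarith
  have h := (hC.moment_le hp hζ hμ (t := 0) (Y := fun _ => 1) (G := fun _ _ => 0)
    (memLp_const 1) aestronglyMeasurable_const (fun _ => aestronglyMeasurable_const)
    (fun _ => memLp_const 0) (by simp [Real.zero_rpow hp0.ne', Real.zero_rpow
      (show 2 / p ≠ 0 by positivity)]) (by simp)).2
  simpa [Real.zero_rpow hp0.ne', Real.zero_rpow (show 2 / p ≠ 0 by positivity),
    Real.zero_rpow (show p / 2 ≠ 0 by positivity)] using h

/-! ### Convolution inequalities -/

/-- A renewal inequality with defect: the mass escaping to `V` beyond the horizon `n` tends to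
zero with `n`, because the total mass of `b` is less than one. -/
theorem tendsto_zero_of_le_tsum_mul {b : ℕ → ℝ} {V : ℝ} {D : ℤ → ℕ → ℝ} (hb0 : ∀ j, 0 ≤ b j)
    (hb : Summable b) (hb1 : ∑' j, b j < 1) (hD0 : ∀ t n, 0 ≤ D t n) (hDV : ∀ t n, D t n ≤ V)
    (hrec : ∀ t n, D t n ≤ ∑' j, b j * if j ≤ n then D (t - j) (n - j) else V) (t : ℤ) :
    Tendsto (D t) atTop (𝓝 0) := by
  have hV : 0 ≤ V := (hD0 0 0).trans (hDV 0 0)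
  -- the supremum over all times and all later horizons is antitone, hence converges
  let f : ℕ → ℝ := fun n => ⨆ x : ℤ × ℕ, D x.1 (n + x.2)
  have hbdd : ∀ n, BddAbove (Set.range fun x : ℤ × ℕ => D x.1 (n + x.2)) := fun n =>
    ⟨V, by rintro _ ⟨x, rfl⟩; exact hDV _ _⟩
  have hDf : ∀ t n m, n ≤ m → D t m ≤ f n := fun t n m h => by
    have := le_ciSup (hbdd n) (t, m - n)
    simpa only [Nat.add_sub_cancel' h] using this
  have hf0 : ∀ n, 0 ≤ f n := fun n => (hD0 0 n).trans (hDf 0 n n le_rfl)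
  have hfV : ∀ n, f n ≤ V := fun n => ciSup_le fun x => hDV _ _
  have hanti : Antitone f := fun n m h => ciSup_le fun x => hDf _ _ _ (by omega)
  have hsum : ∀ G : ℕ → ℝ, (∀ j, 0 ≤ G j) → (∀ j, G j ≤ V) → Summable fun j => b j * G j :=
    fun G h0 hGV => Summable.of_nonneg_of_le (fun j => mul_nonneg (hb0 j) (h0 j))
      (fun j => mul_le_mul_of_nonneg_left (hGV j) (hb0 j)) (hb.mul_right V)
  have hfrec : ∀ n, f n ≤ ∑' j, b j * if j ≤ n then f (n - j) else V := by
    refine fun n => ciSup_le fun x => (hrec _ _).trans ?_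
    refine Summable.tsum_le_tsum (fun j => mul_le_mul_of_nonneg_left ?_ (hb0 j))
      (hsum _ (fun j => ?_) fun j => ?_) (hsum _ (fun j => ?_) fun j => ?_)
    · split_ifs with h1 h2 h2
      · exact hDf _ _ _ (by omega)
      · exact hDV _ _
      · omega
      · exact le_rfl
    · split_ifs; exacts [hD0 _ _, hV]
    · split_ifs; exacts [hDV _ _, le_rfl]
    · split_ifs; exacts [hf0 _, hV]
    · split_ifs; exacts [hfV _, le_rfl]
  have hlim := tendsto_atTop_ciInf hanti ⟨0, by rintro _ ⟨n, rfl⟩; exact hf0 n⟩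
  set L := ⨅ n, f n
  have hlim2 : Tendsto (fun n => ∑' j, b j * if j ≤ n then f (n - j) else V) atTop
      (𝓝 (∑' j, b j * L)) := by
    refine tendsto_tsum_of_dominated_convergence (hb.mul_right V) (fun j => ?_)
      (Eventually.of_forall fun n j => ?_)
    · refine Tendsto.const_mul _ ((hlim.comp (tendsto_sub_atTop_nat j)).congr' ?_)
      filter_upwards [eventually_ge_atTop j] with n hn
      simp [hn]
    · rw [norm_mul, Real.norm_of_nonneg (hb0 j)]
      refine mul_le_mul_of_nonneg_left ?_ (hb0 j)
      split_ifs
      · rw [Real.norm_of_nonneg (hf0 _)]; exact hfV _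
      · rw [Real.norm_of_nonneg hV]
  have hL := le_of_tendsto_of_tendsto' hlim hlim2 hfrec
  have hL0 : 0 ≤ L := ge_of_tendsto' hlim hf0
  rw [tsum_mul_right] at hL
  have hLz : L = 0 := by nlinarith
  rw [hLz] at hlim
  exact squeeze_zero (hD0 t) (fun n => hDf t n n le_rfl) hlim

/-- Summing the convolution inequality over `n < N` gives `S ≤ c * (B + m * B * S)` for the partial
sum `S` of `a`, with `B = ∑ b`, which is solved for `S`. -/
theorem summable_and_tsum_le_of_le_conv {a b : ℕ → ℝ} {c m : ℝ} (ha : ∀ n, 0 ≤ a n)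
    (hb0 : ∀ n, 0 ≤ b n) (hb : Summable b) (hc : 0 ≤ c) (hm : 0 ≤ m)
    (h1 : c * m * ∑' n, b n < 1)
    (hrec : ∀ n, a n ≤ c * (b n + m * ∑ k ∈ Finset.range n, b (n - k) * a k)) :
    Summable a ∧ ∑' n, a n ≤ c * (∑' n, b n) / (1 - c * m * ∑' n, b n) := by
  have key : ∀ N, ∑ n ∈ Finset.range N, a n ≤ c * (∑' n, b n) / (1 - c * m * ∑' n, b n) := by
    intro N
    have hconv : ∑ n ∈ Finset.range N, ∑ k ∈ Finset.range n, b (n - k) * a k ≤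
        (∑' n, b n) * ∑ k ∈ Finset.range N, a k := by
      rw [Finset.sum_comm' (s' := fun k => Finset.Ico (k + 1) N) (t' := Finset.range N)
        (fun n k => by simp only [Finset.mem_range, Finset.mem_Ico]; omega), Finset.mul_sum]
      refine Finset.sum_le_sum fun k _ => ?_
      rw [← Finset.sum_mul]
      refine mul_le_mul_of_nonneg_right ?_ (ha k)
      refine (Finset.sum_le_sum_of_subset_of_nonneg (Finset.Ico_subset_Ico_left k.le_succ)
        fun i _ _ => hb0 _).trans ?_
      rw [Finset.sum_Ico_eq_sum_range]
      simp only [Nat.add_sub_cancel_left]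
      exact hb.sum_le_tsum _ fun i _ => hb0 i
    have h2 : ∑ n ∈ Finset.range N, a n ≤
        c * (∑' n, b n + m * ((∑' n, b n) * ∑ k ∈ Finset.range N, a k)) := by
      refine (Finset.sum_le_sum fun n _ => hrec n).trans ?_
      rw [← Finset.mul_sum, Finset.sum_add_distrib, ← Finset.mul_sum]
      gcongr
      exact hb.sum_le_tsum _ fun i _ => hb0 i
    rw [le_div_iff₀ (by linarith)]
    nlinarith
  exact ⟨summable_of_sum_range_le ha key, Real.tsum_le_of_sum_range_le ha key⟩

/-! ### Volterra coefficients of the LARCH recursion -/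

/-- The coefficient of `ζ (t - n)` in the Volterra expansion of the volatility at time `t` (divided
by `α`), evaluated at a path `z` of the innovations:
`∑ β j₁ ⋯ β jₘ * z (t - j₁) * z (t - j₁ - j₂) ⋯`, over all `m ≥ 1` and `j₁ + ⋯ + jₘ = n`, each
product having `m - 1` factors `z`.  The recursion splits off the last jump `n - k`. -/
def volterraCoeff (β : ℕ → ℝ) (z : ℤ → ℝ) (t : ℤ) (n : ℕ) : ℝ :=
  β n + ∑ k : Fin n, β (n - k) * z (t - (k : ℕ)) * volterraCoeff β z t k
termination_by n

section Volterra

variable {β : ℕ → ℝ} (z : ℤ → ℝ)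

theorem volterraCoeff_eq (t : ℤ) (n : ℕ) : volterraCoeff β z t n =
    β n + ∑ k ∈ Finset.range n, β (n - k) * z (t - k) * volterraCoeff β z t k := by
  rw [volterraCoeff, Finset.sum_range fun k => β (n - k) * z (t - k) * volterraCoeff β z t k]

theorem volterraCoeff_zero (t : ℤ) : volterraCoeff β z t 0 = β 0 := by
  rw [volterraCoeff_eq, Finset.range_zero, Finset.sum_empty, add_zero]

/-- A double sum over `j < k < n` may be taken over the first jump `j` and the remainder
`i = k - j`. -/
theorem sum_range_sum_range_eq_of_zero (n : ℕ) (f : ℕ → ℕ → ℝ) (hf : ∀ j, f j 0 = 0) :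
    ∑ k ∈ Finset.range n, ∑ j ∈ Finset.range k, f j (k - j) =
      ∑ j ∈ Finset.range n, ∑ i ∈ Finset.range (n - j), f j i := by
  rw [Finset.sum_comm' (s' := fun j => Finset.Ico (j + 1) n) (t' := Finset.range n)
    (fun n k => by simp only [Finset.mem_range, Finset.mem_Ico]; omega)]
  refine Finset.sum_congr rfl fun j hj => ?_
  have hj' := Finset.mem_range.1 hj
  have h : ∑ k ∈ Finset.Ico j n, f j (k - j) = ∑ i ∈ Finset.range (n - j), f j i := by
    rw [Finset.sum_Ico_eq_sum_range]
    simp only [Nat.add_sub_cancel_left]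
  rw [← h, Finset.sum_eq_sum_Ico_succ_bot hj', Nat.sub_self, hf, zero_add]

/-- The recursion for the Volterra coefficients that splits off the first jump `k`. -/
theorem volterraCoeff_eq_first (hβ : β 0 = 0) (t : ℤ) (n : ℕ) : volterraCoeff β z t n =
    β n + ∑ k ∈ Finset.range n, β k * z (t - k) * volterraCoeff β z (t - k) (n - k) := by
  induction n using Nat.strong_induction_on generalizing t with
  | _ n ih =>
  have hL : ∑ k ∈ Finset.range n, β (n - k) * z (t - k) * volterraCoeff β z t k =
      ∑ k ∈ Finset.range n, β (n - k) * z (t - k) * β k +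
      ∑ k ∈ Finset.range n, ∑ j ∈ Finset.range k, β (n - j - (k - j)) * z (t - j - (k - j : ℕ)) *
        (β j * z (t - j) * volterraCoeff β z (t - j) (k - j)) := by
    rw [← Finset.sum_add_distrib]
    refine Finset.sum_congr rfl fun k hk => ?_
    rw [ih k (Finset.mem_range.1 hk), mul_add, Finset.mul_sum]
    congr 1
    refine Finset.sum_congr rfl fun j hj => ?_
    have hj' := Finset.mem_range.1 hj
    rw [show n - j - (k - j) = n - k by omega, show t - (j : ℤ) - (k - j : ℕ) = t - k by omega]
  have hR : ∑ k ∈ Finset.range n, β k * z (t - k) * volterraCoeff β z (t - k) (n - k) =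
      ∑ k ∈ Finset.range n, β (n - k) * z (t - k) * β k +
      ∑ j ∈ Finset.range n, ∑ i ∈ Finset.range (n - j), β (n - j - i) * z (t - j - i) *
        (β j * z (t - j) * volterraCoeff β z (t - j) i) := by
    rw [← Finset.sum_add_distrib]
    refine Finset.sum_congr rfl fun k _ => ?_
    rw [volterraCoeff_eq z (t - k) (n - k), mul_add, Finset.mul_sum]
    congr 1
    · ring
    · exact Finset.sum_congr rfl fun j _ => by ring
  rw [volterraCoeff_eq, hL, hR, sum_range_sum_range_eq_of_zero n (fun j i =>
    β (n - j - i) * z (t - j - i) * (β j * z (t - j) * volterraCoeff β z (t - j) i))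
    (fun j => by simp [volterraCoeff_zero, hβ])]

/-- The volatility at time `t` of the LARCH recursion that is started at time `t - n` with all
earlier returns equal to zero, evaluated at a path `z` of the innovations. -/
def truncatedVolatility (α : ℝ) (β : ℕ → ℝ) (z : ℤ → ℝ) (t : ℤ) (n : ℕ) : ℝ :=
  α + ∑ k ∈ Finset.range (n + 1), α * volterraCoeff β z t k * z (t - k)

theorem truncatedVolatility_eq (α : ℝ) (hβ : β 0 = 0) (t : ℤ) (n : ℕ) :
    truncatedVolatility α β z t n = α + ∑ j ∈ Finset.range (n + 1),
      β j * (truncatedVolatility α β z (t - j) (n - j) * z (t - j)) := by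
  have hL : ∑ k ∈ Finset.range (n + 1), α * volterraCoeff β z t k * z (t - k) =
      ∑ k ∈ Finset.range (n + 1), α * β k * z (t - k) +
      ∑ k ∈ Finset.range (n + 1), ∑ j ∈ Finset.range k, β j * z (t - j) *
        (α * volterraCoeff β z (t - j) (k - j) * z (t - j - (k - j : ℕ))) := by
    rw [← Finset.sum_add_distrib]
    refine Finset.sum_congr rfl fun k _ => ?_
    rw [volterraCoeff_eq_first z hβ, mul_add, add_mul, Finset.mul_sum, Finset.sum_mul]
    congr 1
    refine Finset.sum_congr rfl fun j hj => ?_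
    have hj' := Finset.mem_range.1 hj
    rw [show t - (j : ℤ) - (k - j : ℕ) = t - k by omega]
    ring
  rw [truncatedVolatility, hL, sum_range_sum_range_eq_of_zero (n + 1) (fun j i =>
    β j * z (t - j) * (α * volterraCoeff β z (t - j) i * z (t - j - i)))
    (fun j => by simp [volterraCoeff_zero, hβ]), ← Finset.sum_add_distrib]
  congr 1
  refine Finset.sum_congr rfl fun j hj => ?_
  have hj' := Finset.mem_range.1 hj
  rw [truncatedVolatility, ← Finset.mul_sum, show n + 1 - j = n - j + 1 by omega]
  ring

end Volterra

/-! ### Moments of the Volterra coefficients -/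

/-- The moment inequality in terms of squared `L ^ p` norms. -/
theorem rpow_two_div_le_of_le {p C x e μ s : ℝ} (hp : 2 ≤ p) (hC : 0 ≤ C) (hx : 0 ≤ x)
    (hμ : 0 ≤ μ) (hs : 0 ≤ s) (h : x ≤ C * (|e| ^ p + μ * s ^ (p / 2))) :
    x ^ (2 / p) ≤ C ^ (2 / p) * (e ^ 2 + μ ^ (2 / p) * s) := by
  have hp0 : 0 < p := by linarith
  have h1 := Real.rpow_le_rpow hx h (by positivity : 0 ≤ 2 / p)
  rw [Real.mul_rpow hC (by positivity)] at h1
  refine h1.trans (mul_le_mul_of_nonneg_left ?_ (by positivity))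
  refine (Real.rpow_add_le_add_rpow (by positivity) (by positivity) (by positivity)
    ((div_le_one hp0).2 hp)).trans (le_of_eq ?_)
  rw [← Real.rpow_mul (abs_nonneg _), mul_div_cancel₀ _ hp0.ne', Real.rpow_two, sq_abs,
    Real.mul_rpow hμ (by positivity), rpow_two_div_rpow hp0.ne' hs]

theorem rpow_integral_const_mul {Ω : Type*} [MeasurableSpace Ω] {P : Measure Ω} {p : ℝ}
    (hp : 0 < p) (c : ℝ) (X : Ω → ℝ) :
    (∫ ω, |c * X ω| ^ p ∂P) ^ (2 / p) = c ^ 2 * (∫ ω, |X ω| ^ p ∂P) ^ (2 / p) := by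
  simp only [abs_mul, Real.mul_rpow (abs_nonneg c) (abs_nonneg _), integral_const_mul]
  rw [Real.mul_rpow (by positivity) (integral_nonneg fun ω => by positivity),
    ← Real.rpow_mul (abs_nonneg c), mul_div_cancel₀ _ hp.ne', Real.rpow_two, sq_abs]

section Coefficients

variable {Ω : Type u} {ζ : ℤ → Ω → ℝ} {β : ℕ → ℝ}

/-- The products in `volterraCoeff β z t n` involve the innovations strictly between `t - n` and `t`
only; the assumption `β 0 = 0` excludes jumps of length zero. -/
theorem measurable_volterraCoeff (t : ℤ) (n : ℕ) (hβ : β 0 = 0) :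
    Measurable[innovationSigma ζ (Set.Icc (t - n + 1) (t - 1))]
      (fun ω => volterraCoeff β (fun u => ζ u ω) t n) := by
  induction n using Nat.strong_induction_on with
  | _ n ih =>
  simp only [volterraCoeff_eq _ t n]
  refine measurable_const.add (Finset.measurable_sum _ fun k hk => ?_)
  have hk' := Finset.mem_range.1 hk
  rcases Nat.eq_zero_or_pos k with rfl | hk0
  · simp only [volterraCoeff_zero, hβ, mul_zero]
    exact measurable_const
  · refine (measurable_const.mul (measurable_innovationSigma ?_)).mul
      ((ih k hk').mono (innovationSigma_mono (Set.Icc_subset_Icc (by omega) le_rfl)) le_rfl)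
    simp only [Set.mem_Icc]; omega

variable [mΩ : MeasurableSpace Ω] {P : Measure Ω}

theorem aestronglyMeasurable_volterraCoeff (hβ : β 0 = 0) (t : ℤ) (n : ℕ) :
    AEStronglyMeasurable[innovationSigma ζ (Set.Icc (t - n + 1) t)]
      (fun ω => volterraCoeff β (fun u => ζ u ω) t n) P :=
  ((measurable_volterraCoeff t n hβ).mono (innovationSigma_mono
    (Set.Icc_subset_Icc le_rfl (by omega))) le_rfl).stronglyMeasurable.aestronglyMeasurable

variable [IsProbabilityMeasure P]

theorem memLp_volterraCoeff (hζ : IsStandardizedIID ζ P) (hβ : β 0 = 0) {p : ℝ} (hp : 0 < p)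
    (hμ : Integrable (fun ω => |ζ 0 ω| ^ p) P) (t : ℤ) (n : ℕ) :
    MemLp (fun ω => volterraCoeff β (fun u => ζ u ω) t n) (ENNReal.ofReal p) P := by
  induction n using Nat.strong_induction_on with
  | _ n ih =>
  simp only [volterraCoeff_eq _ t n]
  refine (memLp_const (β n)).add (memLp_finsetSum _ fun k hk => ?_)
  have h1 := (indepFun_of_indep_comap ((hζ.pastScheme t).indep k)
    (aestronglyMeasurable_volterraCoeff hβ t k)).memLp_mul hp (ih k (Finset.mem_range.1 hk))
    (hζ.memLp hp hμ _)
  refine MemLp.ae_eq (ae_of_all _ fun ω => ?_) (h1.const_mul (β (n - k)))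
  ring

/-- The Volterra coefficients over a horizon `n` are themselves projective in the innovations, with
coefficients `β (n - k)` times those over shorter horizons; the moment inequality turns this into a
convolution inequality. -/
theorem IsRosenthalConstant.rpow_integral_volterraCoeff_le {p C : ℝ} (hp : 2 ≤ p)
    (hC : IsRosenthalConstant.{u} p C) (hζ : IsStandardizedIID ζ P) (hβ : β 0 = 0)
    (hμ : Integrable (fun ω => |ζ 0 ω| ^ p) P) (t : ℤ) (n : ℕ) :
    (∫ ω, |volterraCoeff β (fun u => ζ u ω) t n| ^ p ∂P) ^ (2 / p) ≤
      C ^ (2 / p) * (β n ^ 2 + (∫ ω, |ζ 0 ω| ^ p ∂P) ^ (2 / p) *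
        ∑ k ∈ Finset.range n, β (n - k) ^ 2 *
          (∫ ω, |volterraCoeff β (fun u => ζ u ω) t k| ^ p ∂P) ^ (2 / p)) := by
  have hp0 : 0 < p := by linarith
  let G : ℕ → Ω → ℝ := fun k ω =>
    (if k < n then β (n - k) else 0) * volterraCoeff β (fun u => ζ u ω) t k
  have hG : ∀ k : ℕ, AEStronglyMeasurable[innovationSigma ζ (Set.Icc (t - k + 1) t)] (G k) P :=
    fun k => (aestronglyMeasurable_volterraCoeff hβ t k).const_mul _
  have hGp : ∀ k, MemLp (G k) (ENNReal.ofReal p) P := fun k =>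
    (memLp_volterraCoeff hζ hβ hp0 hμ t k).const_mul _
  have hY : ∀ N, n ≤ N → ∀ ω, volterraCoeff β (fun u => ζ u ω) t n =
      β n + ∑ k ∈ Finset.range N, G k ω * ζ (t - k) ω := by
    intro N hN ω
    rw [volterraCoeff_eq]
    congr 1
    refine Finset.sum_subset_zero_on_sdiff (Finset.range_subset_range.2 hN) (fun k hk => ?_)
      fun k hk => ?_
    · simp only [Finset.mem_sdiff, Finset.mem_range, not_lt] at hk
      simp [G, hk.2]
    · simp only [G, if_pos (Finset.mem_range.1 hk)]
      ring
  have hmean : ∫ ω, volterraCoeff β (fun u => ζ u ω) t n ∂P = β n := by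
    simp only [hY n le_rfl]
    exact (hζ.pastScheme t).integral_sum (β n) (fun k => hζ.memLp_two _) hG
      (fun k => (hGp k).two_of_ofReal hp) n
  have hmom : ∀ k, (∫ ω, |G k ω| ^ p ∂P) ^ (2 / p) = (if k < n then β (n - k) else 0) ^ 2 *
      (∫ ω, |volterraCoeff β (fun u => ζ u ω) t k| ^ p ∂P) ^ (2 / p) := fun k =>
    rpow_integral_const_mul hp0 _ _
  have hzero : ∀ k ∉ Finset.range n, (∫ ω, |G k ω| ^ p ∂P) ^ (2 / p) = 0 := by
    intro k hk
    rw [hmom, if_neg (fun h => hk (Finset.mem_range.2 h))]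
    ring
  have hsum : ∑' k, (∫ ω, |G k ω| ^ p ∂P) ^ (2 / p) = ∑ k ∈ Finset.range n, β (n - k) ^ 2 *
      (∫ ω, |volterraCoeff β (fun u => ζ u ω) t k| ^ p ∂P) ^ (2 / p) := by
    rw [tsum_eq_sum hzero]
    refine Finset.sum_congr rfl fun k hk => ?_
    rw [hmom, if_pos (Finset.mem_range.1 hk)]
  have h := (hC.moment_le hp hζ hμ (t := t) (G := G)
    ((memLp_volterraCoeff hζ hβ hp0 hμ t n).two_of_ofReal hp)
    ((aestronglyMeasurable_volterraCoeff hβ t n).mono (innovationSigma_mono Set.Icc_subset_Iic_self))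
    hG hGp (summable_of_ne_finset_zero hzero) (by
      rw [hmean]
      refine tendsto_const_nhds.congr' ?_
      filter_upwards [eventually_ge_atTop n] with N hN
      simp [hY N hN])).2
  rw [hmean, hsum] at h
  exact rpow_two_div_le_of_le hp (zero_le_one.trans (hC.one_le hp hζ hμ))
    (integral_nonneg fun ω => by positivity) (integral_nonneg fun ω => by positivity)
    (Finset.sum_nonneg fun k _ => mul_nonneg (sq_nonneg _)
      (Real.rpow_nonneg (integral_nonneg fun ω => by positivity) _)) h

end Coefficients

/-! ### Uniqueness of the stationary solution -/

section Solution

variable {Ω : Type u} [mΩ : MeasurableSpace Ω] {P : Measure Ω}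
  {ζ : ℤ → Ω → ℝ} {α : ℝ} {β : ℕ → ℝ} {r σ : ℤ → Ω → ℝ}

theorem IsLarchSolution.indepFun (h : IsLarchSolution ζ P α β r σ) (hζ : IsStandardizedIID ζ P)
    (t : ℤ) : IndepFun (σ t) (ζ t) P :=
  indepFun_of_indep_comap (hζ.indep_innovationSigma (by simp)) (h.predictable t)

theorem aestronglyMeasurable_truncatedVolatility (hβ : β 0 = 0) (t : ℤ) (n : ℕ) :
    AEStronglyMeasurable[innovationSigma ζ (Set.Iic (t - 1))]
      (fun ω => truncatedVolatility α β (fun u => ζ u ω) t n) P := by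
  refine Measurable.aestronglyMeasurable ?_
  unfold truncatedVolatility
  refine measurable_const.add (Finset.measurable_sum _ fun k _ => ?_)
  rcases Nat.eq_zero_or_pos k with rfl | hk0
  · simp only [volterraCoeff_zero, hβ, mul_zero, zero_mul]
    exact measurable_const
  · exact (measurable_const.mul ((measurable_volterraCoeff t k hβ).mono (innovationSigma_mono
      Set.Icc_subset_Iic_self) le_rfl)).mul (measurable_innovationSigma (by simp; omega))

variable [IsProbabilityMeasure P]

namespace IsLarchSolution

theorem memLp_volatility (h : IsLarchSolution ζ P α β r σ) (hζ : IsStandardizedIID ζ P) (t : ℤ) :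
    MemLp (σ t) 2 P := by
  have hm : AEStronglyMeasurable (σ t) P := (h.predictable t).mono (hζ.innovationSigma_le _)
  have hS : ∀ n : ℕ, MemLp (fun ω => α + ∑ j ∈ Finset.Icc 1 n, β j * r (t - j) ω) 2 P := fun n =>
    (memLp_const α).add (memLp_finsetSum _ fun j _ => (h.second_order _).const_mul _)
  obtain ⟨n, hn⟩ := ((h.volatility_eq t).eventually (gt_mem_nhds ENNReal.zero_lt_top)).exists
  have hd : MemLp (fun ω => σ t ω - (α + ∑ j ∈ Finset.Icc 1 n, β j * r (t - j) ω)) 2 P :=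
    ⟨hm.sub (hS n).1, hn⟩
  refine MemLp.ae_eq (ae_of_all _ fun ω => ?_) (hd.add (hS n))
  simp

theorem integral_volatility_sq (h : IsLarchSolution ζ P α β r σ) (hζ : IsStandardizedIID ζ P)
    (t : ℤ) : ∫ ω, σ t ω ^ 2 ∂P = ∫ ω, r 0 ω ^ 2 ∂P := by
  have h1 := (h.indepFun hζ t).integral_abs_mul_rpow (h.memLp_volatility hζ t).1
    (hζ.memLp_two t).1 2
  simp only [Real.rpow_two, sq_abs, hζ.integral_sq, mul_one] at h1
  have h2 : ∫ ω, r t ω ^ 2 ∂P = ∫ ω, r 0 ω ^ 2 ∂P := by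
    have := ((h.strictly_stationary t).comp (u := fun x : ℤ → ℝ => x 0 ^ 2)
      (by fun_prop)).integral_eq
    simpa using this
  rw [← h1, ← h2]
  refine integral_congr_ae ?_
  filter_upwards [h.return_eq t] with ω hω
  rw [hω]

end IsLarchSolution

theorem memLp_truncatedVolatility (hζ : IsStandardizedIID ζ P) (hβ : β 0 = 0) (t : ℤ) (n : ℕ) :
    MemLp (fun ω => truncatedVolatility α β (fun u => ζ u ω) t n) 2 P := by
  have e2 : (2 : ENNReal) = ENNReal.ofReal 2 := by simp
  have h2 : Integrable (fun ω => |ζ 0 ω| ^ (2 : ℝ)) P := by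
    simpa only [Real.rpow_two, sq_abs] using (hζ.memLp_two 0).integrable_sq
  rw [e2]
  exact (hζ.pastScheme t).memLp_sum two_pos α (fun k => hζ.memLp two_pos h2 _)
    (fun k => (aestronglyMeasurable_volterraCoeff hβ t k).const_mul α)
    (fun k => (memLp_volterraCoeff hζ hβ two_pos h2 t k).const_mul α) (n + 1)

/-- Orthogonality of predictable multiples of the innovations, indexed by the lag. -/
theorem integral_sq_sum_lag (hζ : IsStandardizedIID ζ P) (t : ℤ) (N : ℕ) {Z : ℕ → Ω → ℝ}
    (hZ : ∀ j : ℕ, AEStronglyMeasurable[innovationSigma ζ (Set.Iic (t - j - 1))] (Z j) P)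
    (hZ2 : ∀ j, MemLp (Z j) 2 P) :
    ∫ ω, (∑ j ∈ Finset.range (N + 1), Z j ω * ζ (t - j) ω) ^ 2 ∂P =
      ∑ j ∈ Finset.range (N + 1), ∫ ω, Z j ω ^ 2 ∂P := by
  -- reversing the lags makes the sum a martingale in forward time, started at `t - N`
  let G : ℕ → Ω → ℝ := fun k => if k ≤ N then Z (N - k) else 0
  have hG : ∀ k : ℕ, AEStronglyMeasurable[innovationSigma ζ (Set.Iic (t - N + k - 1))] (G k) P := by
    intro k
    by_cases hk : k ≤ N
    · simp only [G, if_pos hk]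
      have := hZ (N - k)
      rwa [show t - ((N - k : ℕ) : ℤ) - 1 = t - N + k - 1 by omega] at this
    · simp only [G, if_neg hk]
      exact aestronglyMeasurable_zero
  have hG2 : ∀ k, MemLp (G k) 2 P := by
    intro k
    by_cases hk : k ≤ N
    · simp only [G, if_pos hk]; exact hZ2 _
    · simp only [G, if_neg hk]; exact MemLp.zero
  have h := (hζ.futureScheme (t - N)).integral_sq_sum 0 (fun _ => hζ.memLp_two _)
    (fun _ => hζ.integral_sq _) hG hG2 (N + 1)
  rw [← Finset.sum_range_reflect (fun j => ∫ ω, Z j ω ^ 2 ∂P)]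
  simp only [zero_add, ne_eq, OfNat.ofNat_ne_zero, not_false_eq_true, zero_pow] at h
  refine Eq.trans (integral_congr_ae (ae_of_all _ fun ω => ?_)) (h.trans ?_)
  · simp only
    rw [← Finset.sum_range_reflect (fun j => Z j ω * ζ (t - j) ω)]
    congr 1
    refine Finset.sum_congr rfl fun k hk => ?_
    have hk' : k ≤ N := by have := Finset.mem_range.1 hk; omega
    simp only [G, if_pos hk', Nat.add_sub_cancel]
    rw [show t - ((N - k : ℕ) : ℤ) = t - N + k by omega]
  · refine Finset.sum_congr rfl fun k hk => ?_
    have hk' : k ≤ N := by have := Finset.mem_range.1 hk; omega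
    simp only [G, if_pos hk', Nat.add_sub_cancel]

namespace IsLarchSolution

/-- The mean square error of the truncated volatility satisfies a renewal inequality. -/
theorem integral_sq_sub_truncatedVolatility_le (h : IsLarchSolution ζ P α β r σ)
    (hζ : IsStandardizedIID ζ P) (hβ : β 0 = 0) (hsum : Summable fun j => β j ^ 2)
    (t : ℤ) (n : ℕ) :
    ∫ ω, (σ t ω - truncatedVolatility α β (fun u => ζ u ω) t n) ^ 2 ∂P ≤
      ∑' j : ℕ, β j ^ 2 * if j ≤ n then ∫ ω, (σ (t - j) ω -
        truncatedVolatility α β (fun u => ζ u ω) (t - j) (n - j)) ^ 2 ∂P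
        else ∫ ω, r 0 ω ^ 2 ∂P := by
  set d : ℕ → Ω → ℝ := fun j ω => σ (t - j) ω -
    truncatedVolatility α β (fun u => ζ u ω) (t - j) (n - j) with hd
  set V := ∫ ω, r 0 ω ^ 2 ∂P with hV
  -- the coefficient of `ζ (t - j)` in the difference of the two recursions
  let Z : ℕ → Ω → ℝ := fun j ω => β j * if j ≤ n then d j ω else σ (t - j) ω
  have hZm : ∀ j : ℕ, AEStronglyMeasurable[innovationSigma ζ (Set.Iic (t - j - 1))] (Z j) P := by
    intro j
    refine AEStronglyMeasurable.const_mul ?_ _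
    by_cases hj : j ≤ n
    · simp only [if_pos hj]
      exact (h.predictable _).sub (aestronglyMeasurable_truncatedVolatility hβ _ _)
    · simp only [if_neg hj]
      exact h.predictable _
  have hZ2 : ∀ j, MemLp (Z j) 2 P := by
    intro j
    refine MemLp.const_mul ?_ _
    by_cases hj : j ≤ n
    · simp only [if_pos hj]
      exact (h.memLp_volatility hζ _).sub (memLp_truncatedVolatility hζ hβ _ _)
    · simp only [if_neg hj]
      exact h.memLp_volatility hζ _
  have hZsq : ∀ j, ∫ ω, Z j ω ^ 2 ∂P =
      β j ^ 2 * if j ≤ n then ∫ ω, d j ω ^ 2 ∂P else V := by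
    intro j
    simp only [Z, mul_pow, integral_const_mul]
    by_cases hj : j ≤ n
    · simp only [if_pos hj]
    · simp only [if_neg hj, h.integral_volatility_sq hζ]
      rfl
  have hnn : ∀ j, 0 ≤ ∫ ω, Z j ω ^ 2 ∂P := fun j => integral_nonneg fun ω => sq_nonneg _
  have hsumZ : Summable fun j => ∫ ω, Z j ω ^ 2 ∂P := by
    refine (summable_nat_add_iff (n + 1)).1
      (((summable_nat_add_iff (n + 1)).2 (hsum.mul_right V)).congr fun j => ?_)
    rw [hZsq, if_neg (by omega)]
  refine le_of_le_of_eq ?_ (tsum_congr hZsq)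
  -- the LARCH series cut off at lag `N + n`, minus the truncated volatility
  let M : ℕ → Ω → ℝ := fun N ω => (α + ∑ j ∈ Finset.Icc 1 (N + n), β j * r (t - j) ω) -
    truncatedVolatility α β (fun u => ζ u ω) t n
  have hM2 : ∀ N, MemLp (M N) 2 P := fun N =>
    ((memLp_const α).add (memLp_finsetSum _ fun j _ => (h.second_order _).const_mul _)).sub
      (memLp_truncatedVolatility hζ hβ t n)
  have hMZ : ∀ N, M N =ᵐ[P] fun ω => ∑ j ∈ Finset.range (N + n + 1), Z j ω * ζ (t - j) ω := by
    intro N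
    filter_upwards [ae_all_iff.2 fun j : ℕ => h.return_eq (t - j)] with ω hω
    have h1 : ∑ j ∈ Finset.Icc 1 (N + n), β j * r (t - j) ω =
        ∑ j ∈ Finset.range (N + n + 1), β j * (σ (t - j) ω * ζ (t - j) ω) := by
      rw [Finset.range_eq_Ico, Finset.sum_eq_sum_Ico_succ_bot (Nat.succ_pos _), hβ, zero_mul,
        zero_add]
      exact Finset.sum_congr rfl fun j _ => by rw [hω]
    have h2 : ∑ j ∈ Finset.range (n + 1),
        β j * (truncatedVolatility α β (fun u => ζ u ω) (t - j) (n - j) * ζ (t - j) ω) =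
        ∑ j ∈ Finset.range (N + n + 1), β j * ((if j ≤ n then
          truncatedVolatility α β (fun u => ζ u ω) (t - j) (n - j) else 0) * ζ (t - j) ω) := by
      refine Finset.sum_subset_zero_on_sdiff (Finset.range_subset_range.2 (by omega))
        (fun j hj => ?_) fun j hj => ?_
      · simp only [Finset.mem_sdiff, Finset.mem_range, not_lt] at hj
        rw [if_neg (by omega)]; ring
      · rw [if_pos (by have := Finset.mem_range.1 hj; omega)]
    simp only [M]
    rw [truncatedVolatility_eq _ α hβ, h1, h2, add_sub_add_left_eq_sub, ← Finset.sum_sub_distrib]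
    refine Finset.sum_congr rfl fun j _ => ?_
    simp only [Z, hd]
    split_ifs <;> ring
  have hbound : ∀ N, ∫ ω, |M N ω| ^ (2 : ℝ) ∂P ≤ ∑' j, ∫ ω, Z j ω ^ 2 ∂P := by
    intro N
    simp only [Real.rpow_two, sq_abs]
    calc ∫ ω, M N ω ^ 2 ∂P
        = ∫ ω, (∑ j ∈ Finset.range (N + n + 1), Z j ω * ζ (t - j) ω) ^ 2 ∂P :=
          integral_congr_ae ((hMZ N).fun_comp fun x => x ^ 2)
      _ = ∑ j ∈ Finset.range (N + n + 1), ∫ ω, Z j ω ^ 2 ∂P :=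
          integral_sq_sum_lag hζ t (N + n) hZm hZ2
      _ ≤ _ := hsumZ.sum_le_tsum _ fun j _ => hnn j
  have hfin := (integrable_and_integral_rpow_le_of_tendsto two_pos
    ((h.memLp_volatility hζ t).sub (memLp_truncatedVolatility (α := α) hζ hβ t n)).1
    (fun N => by simpa using hM2 N) hbound (by
      refine ((h.volatility_eq t).comp (tendsto_add_atTop_nat n)).congr fun N => ?_
      refine congrArg (fun f => eLpNorm f 2 P) (funext fun ω => ?_)
      simp only [M, Pi.sub_apply]
      ring)).2
  simpa only [Real.rpow_two, sq_abs, Pi.sub_apply] using hfin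

/-- If `∑ β j ^ 2 < 1`, the volatility of a stationary solution is the limit in mean square of its
truncations, hence is given by the Volterra series. -/
theorem tendsto_eLpNorm_sub_truncatedVolatility (h : IsLarchSolution ζ P α β r σ)
    (hζ : IsStandardizedIID ζ P) (hβ : β 0 = 0) (hsum : Summable fun j => β j ^ 2)
    (hB : ∑' j, β j ^ 2 < 1) (t : ℤ) :
    Tendsto (fun n : ℕ => eLpNorm
      (fun ω => σ t ω - truncatedVolatility α β (fun u => ζ u ω) t n) 2 P) atTop (𝓝 0) := by
  set V := ∫ ω, r 0 ω ^ 2 ∂P with hV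
  have hV0 : 0 ≤ V := integral_nonneg fun ω => sq_nonneg _
  let D : ℤ → ℕ → ℝ := fun t n =>
    ∫ ω, (σ t ω - truncatedVolatility α β (fun u => ζ u ω) t n) ^ 2 ∂P
  have hD0 : ∀ t n, 0 ≤ D t n := fun t n => integral_nonneg fun ω => sq_nonneg _
  have hrec : ∀ t n, D t n ≤ ∑' j, β j ^ 2 * if j ≤ n then D (t - j) (n - j) else V := fun t n =>
    h.integral_sq_sub_truncatedVolatility_le hζ hβ hsum t n
  have hDV : ∀ t n, D t n ≤ V := by
    intro t n
    induction n using Nat.strong_induction_on generalizing t with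
    | _ n ih =>
    have hle : ∀ j : ℕ, β j ^ 2 * (if j ≤ n then D (t - j) (n - j) else V) ≤ β j ^ 2 * V := by
      intro j
      rcases Nat.eq_zero_or_pos j with rfl | hj
      · simp [hβ]
      · refine mul_le_mul_of_nonneg_left ?_ (sq_nonneg _)
        split_ifs with hjn
        · exact ih _ (by omega) _
        · exact le_rfl
    have hS : Summable fun j : ℕ => β j ^ 2 * (if j ≤ n then D (t - j) (n - j) else V) := by
      refine Summable.of_nonneg_of_le (fun j => mul_nonneg (sq_nonneg _) ?_) hle (hsum.mul_right V)
      split_ifs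
      exacts [hD0 _ _, hV0]
    calc D t n ≤ _ := hrec t n
      _ ≤ ∑' j, β j ^ 2 * V := hS.tsum_le_tsum hle (hsum.mul_right V)
      _ = (∑' j, β j ^ 2) * V := tsum_mul_right
      _ ≤ V := mul_le_of_le_one_left hV0 hB.le
  have hD := tendsto_zero_of_le_tsum_mul (fun j => sq_nonneg (β j)) hsum hB hD0 hDV hrec t
  have hnorm : ∀ n, eLpNorm (fun ω => σ t ω - truncatedVolatility α β (fun u => ζ u ω) t n) 2 P =
      ENNReal.ofReal (D t n ^ (2 : ℝ)⁻¹) := by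
    intro n
    have hm : MemLp (fun ω => σ t ω - truncatedVolatility α β (fun u => ζ u ω) t n) 2 P :=
      (h.memLp_volatility hζ t).sub (memLp_truncatedVolatility hζ hβ t n)
    rw [hm.eLpNorm_eq_integral_rpow_norm two_ne_zero ENNReal.ofNat_ne_top]
    simp only [ENNReal.toReal_ofNat, Real.rpow_two, Real.norm_eq_abs, sq_abs]
    rfl
  simp only [hnorm]
  have h1 := (hD.rpow_const (p := (2 : ℝ)⁻¹) (Or.inr (by norm_num)))
  rw [Real.zero_rpow (by norm_num)] at h1
  have h2 := (ENNReal.continuous_ofReal.tendsto 0).comp h1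
  rwa [ENNReal.ofReal_zero] at h2

end IsLarchSolution

end Solution

/-! ### Moments of the stationary solution -/

section Moments

variable {Ω : Type u} [mΩ : MeasurableSpace Ω] {P : Measure Ω} [IsProbabilityMeasure P]
  {ζ : ℤ → Ω → ℝ} {α : ℝ} {β : ℕ → ℝ} {r σ : ℤ → Ω → ℝ}

/-- The moment bounds for a LARCH volatility, under the normalization `β 0 = 0`. -/
theorem IsLarchSolution.moment_le {p C : ℝ} (hp : 2 ≤ p) (hC : IsRosenthalConstant.{u} p C)
    (hζ : IsStandardizedIID ζ P) (hμ : Integrable (fun ω => |ζ 0 ω| ^ p) P)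
    (h : IsLarchSolution ζ P α β r σ) (hβ : β 0 = 0) (hsum : Summable fun j => β j ^ 2)
    (hB : C ^ (2 / p) * (∫ ω, |ζ 0 ω| ^ p ∂P) ^ (2 / p) * ∑' j, β j ^ 2 < 1) (t : ℤ) :
    Integrable (fun ω => |σ t ω| ^ p) P ∧
      (∫ ω, |σ t ω - α| ^ p ∂P) ^ (2 / p) ≤
        C ^ (2 / p) * (∫ ω, |ζ 0 ω| ^ p ∂P) ^ (2 / p) * (α ^ 2 *
          (C ^ (2 / p) * (∑' j, β j ^ 2) /
            (1 - C ^ (2 / p) * (∫ ω, |ζ 0 ω| ^ p ∂P) ^ (2 / p) * ∑' j, β j ^ 2))) ∧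
      (∫ ω, |σ t ω| ^ p ∂P) ^ (2 / p) ≤
        C ^ (2 / p) * (α ^ 2 + (∫ ω, |ζ 0 ω| ^ p ∂P) ^ (2 / p) * (α ^ 2 *
          (C ^ (2 / p) * (∑' j, β j ^ 2) /
            (1 - C ^ (2 / p) * (∫ ω, |ζ 0 ω| ^ p ∂P) ^ (2 / p) * ∑' j, β j ^ 2)))) := by
  have hp0 : 0 < p := by linarith
  have hC1 : 1 ≤ C := hC.one_le hp hζ hμ
  have hC0 : 0 ≤ C := zero_le_one.trans hC1
  have hμ1 := hζ.one_le_moment hp hμ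
  set μ := ∫ ω, |ζ 0 ω| ^ p ∂P with hμdef
  have hμ0 : 0 ≤ μ := zero_le_one.trans hμ1
  have hBn : 0 ≤ ∑' j, β j ^ 2 := tsum_nonneg fun j => sq_nonneg _
  -- as `C` and the moment are at least one, `∑ β j ^ 2 < 1`
  have hB1 : ∑' j, β j ^ 2 < 1 := by
    refine lt_of_le_of_lt (le_mul_of_one_le_left hBn ?_) hB
    exact one_le_mul_of_one_le_of_one_le (Real.one_le_rpow hC1 (by positivity))
      (Real.one_le_rpow hμ1 (by positivity))
  let a : ℕ → ℝ := fun n => (∫ ω, |volterraCoeff β (fun u => ζ u ω) t n| ^ p ∂P) ^ (2 / p)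
  have ha0 : ∀ n, 0 ≤ a n := fun n => Real.rpow_nonneg (integral_nonneg fun ω => by positivity) _
  obtain ⟨hasum, hale⟩ := summable_and_tsum_le_of_le_conv ha0 (fun n => sq_nonneg (β n)) hsum
    (by positivity) (by positivity) hB
    fun n => hC.rpow_integral_volterraCoeff_le hp hζ hβ hμ t n
  have hA0 : 0 ≤ ∑' n, a n := tsum_nonneg ha0
  set A' := C ^ (2 / p) * (∑' j, β j ^ 2) / (1 - C ^ (2 / p) * μ ^ (2 / p) * ∑' j, β j ^ 2)
  let G : ℕ → Ω → ℝ := fun k ω => α * volterraCoeff β (fun u => ζ u ω) t k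
  have hG : ∀ k : ℕ, AEStronglyMeasurable[innovationSigma ζ (Set.Icc (t - k + 1) t)] (G k) P :=
    fun k => (aestronglyMeasurable_volterraCoeff hβ t k).const_mul _
  have hGp : ∀ k, MemLp (G k) (ENNReal.ofReal p) P := fun k =>
    (memLp_volterraCoeff hζ hβ hp0 hμ t k).const_mul _
  have hGa : ∀ k, (∫ ω, |G k ω| ^ p ∂P) ^ (2 / p) = α ^ 2 * a k := fun k =>
    rpow_integral_const_mul hp0 _ _
  have hGsum : Summable fun k => (∫ ω, |G k ω| ^ p ∂P) ^ (2 / p) := by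
    simp only [hGa]
    exact hasum.mul_left _
  have hGtsum : ∑' k, (∫ ω, |G k ω| ^ p ∂P) ^ (2 / p) = α ^ 2 * ∑' n, a n := by
    simp only [hGa]
    exact tsum_mul_left
  have hσ2 := h.memLp_volatility hζ t
  have hσm : AEStronglyMeasurable[innovationSigma ζ (Set.Iic t)] (σ t) P :=
    (h.predictable t).mono (innovationSigma_mono (Set.Iic_subset_Iic.2 (by omega)))
  have hlim := h.tendsto_eLpNorm_sub_truncatedVolatility hζ hβ hsum hB1 t
  have hmean : ∫ ω, σ t ω ∂P = α :=
    integral_eq_of_tendsto_eLpNorm hσ2 (memLp_truncatedVolatility hζ hβ t)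
      (fun n => (hζ.pastScheme t).integral_sum α (fun k => hζ.memLp_two _) hG
        (fun k => (hGp k).two_of_ofReal hp) (n + 1)) hlim
  have hexp : Tendsto (fun n : ℕ => eLpNorm (fun ω => σ t ω - (α +
      ∑ k ∈ Finset.range n, G k ω * ζ (t - k) ω)) 2 P) atTop (𝓝 0) :=
    (tendsto_add_atTop_iff_nat 1).1 hlim
  have hmean' : ∫ ω, (σ t ω - α) ∂P = 0 := by
    rw [integral_sub (hσ2.integrable one_le_two) (integrable_const α), hmean, integral_const,
      probReal_univ, one_smul, sub_self]
  have h1 := hC.moment_le hp hζ hμ hσ2 hσm hG hGp hGsum (by rw [hmean]; exact hexp)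
  have h2 := hC.moment_le hp hζ hμ (Y := fun ω => σ t ω - α) (hσ2.sub (memLp_const α))
    (hσm.sub aestronglyMeasurable_const) hG hGp hGsum (by
      rw [hmean']
      refine hexp.congr fun n => congrArg (fun f => eLpNorm f 2 P) (funext fun ω => ?_)
      ring)
  rw [hmean, hGtsum] at h1
  rw [hmean', hGtsum] at h2
  have hle : α ^ 2 * ∑' n, a n ≤ α ^ 2 * A' := mul_le_mul_of_nonneg_left hale (sq_nonneg _)
  have e1 := rpow_two_div_le_of_le hp hC0 (integral_nonneg fun ω => by positivity) hμ0
    (by positivity) h1.2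
  have e2 := rpow_two_div_le_of_le hp hC0 (integral_nonneg fun ω => by positivity) hμ0
    (by positivity) h2.2
  refine ⟨h1.1, e2.trans ?_, e1.trans ?_⟩
  · rw [zero_pow two_ne_zero, zero_add, ← mul_assoc]
    gcongr
  · gcongr

end Moments

/-- The value `β 0` does not enter the LARCH equations and may be set to zero. -/
theorem IsLarchSolution.update_zero {Ω : Type u} [MeasurableSpace Ω] {P : Measure Ω}
    {ζ : ℤ → Ω → ℝ} {α : ℝ} {β : ℕ → ℝ} {r σ : ℤ → Ω → ℝ} (h : IsLarchSolution ζ P α β r σ) :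
    IsLarchSolution ζ P α (Function.update β 0 0) r σ where
  predictable := h.predictable
  return_eq := h.return_eq
  second_order := h.second_order
  strictly_stationary := h.strictly_stationary
  volatility_eq := fun t => by
    refine (h.volatility_eq t).congr fun n =>
      congrArg (fun f => eLpNorm f 2 P) (funext fun ω => ?_)
    congr 2
    refine Finset.sum_congr rfl fun j hj => ?_
    rw [Function.update_of_ne (by have := (Finset.mem_Icc.1 hj).1; omega)]

theorem mainTheorem6 (p : ℝ) (hp : 2 ≤ p) :
    (∃ C : ℝ, IsRosenthalConstant.{u} p C) ∧
    ∀ C : ℝ, IsRosenthalConstant.{u} p C →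
    ∀ (Ω : Type u) [MeasurableSpace Ω] (P : Measure Ω) [IsProbabilityMeasure P]
      (ζ : ℤ → Ω → ℝ) (α : ℝ) (β : ℕ → ℝ) (r σ : ℤ → Ω → ℝ) (μ : ℝ),
      IsStandardizedIID ζ P →
      (Summable fun j : ℕ => (β (j + 1)) ^ 2) →
      IsLarchSolution ζ P α β r σ →
      Integrable (fun ω => |ζ 0 ω| ^ p) P →
      μ = ∫ ω, |ζ 0 ω| ^ p ∂P →
      C ^ (1 / p) * μ ^ (1 / p) * larchB β < 1 →
      ∀ t : ℤ,
        Integrable (fun ω => |r t ω| ^ p) P ∧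
        Integrable (fun ω => |σ t ω| ^ p) P ∧
        ∫ ω, |r t ω| ^ p ∂P = μ * ∫ ω, |σ t ω| ^ p ∂P ∧
        (∫ ω, |σ t ω - α| ^ p ∂P) ^ (2 / p) ≤
          α ^ 2 * C ^ (4 / p) * μ ^ (2 / p) * larchB β ^ 2 /
            (1 - C ^ (2 / p) * μ ^ (2 / p) * larchB β ^ 2) ∧
        (∫ ω, |σ t ω| ^ p ∂P) ^ (2 / p) ≤
          α ^ 2 * C ^ (2 / p) / (1 - C ^ (2 / p) * μ ^ (2 / p) * larchB β ^ 2) := by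
  refine ⟨exists_isRosenthalConstant hp, ?_⟩
  intro C hC Ω _ P _ ζ α β r σ μ hζ hsum h hint hμ hlt t
  have hp0 : 0 < p := by linarith
  have hC0 : 0 < C := zero_lt_one.trans_le (hC.one_le hp hζ hint)
  have hμ0 : 0 < μ := by
    rw [hμ]
    exact zero_lt_one.trans_le (hζ.one_le_moment hp hint)
  have hshift : ∀ j, Function.update β 0 0 (j + 1) = β (j + 1) := fun j =>
    Function.update_of_ne j.succ_ne_zero _ _
  have hsum' : Summable fun j => Function.update β 0 0 j ^ 2 := by
    refine (summable_nat_add_iff 1).1 ?_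
    simpa only [hshift] using hsum
  have hBsq : larchB β ^ 2 = ∑' j, Function.update β 0 0 j ^ 2 := by
    rw [larchB, Real.sq_sqrt (tsum_nonneg fun j => sq_nonneg _), hsum'.tsum_eq_zero_add]
    simp only [hshift, Function.update_self]
    ring
  have hsquare : ∀ x : ℝ, 0 ≤ x → (x ^ (1 / p)) ^ 2 = x ^ (2 / p) := fun x hx => by
    rw [← Real.rpow_two, ← Real.rpow_mul hx]
    ring_nf
  have hκ : C ^ (2 / p) * μ ^ (2 / p) * larchB β ^ 2 < 1 := by
    have hB0 : 0 ≤ larchB β := Real.sqrt_nonneg _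
    rw [← hsquare C hC0.le, ← hsquare μ hμ0.le, ← mul_pow, ← mul_pow]
    exact pow_lt_one₀ (by positivity) hlt two_ne_zero
  have hC4 : C ^ (4 / p) = C ^ (2 / p) * C ^ (2 / p) := by
    rw [← Real.rpow_add hC0]
    ring_nf
  obtain ⟨hσ, hb1, hb2⟩ := h.update_zero.moment_le hp hC hζ hint (Function.update_self _ _ _) hsum'
    (by rwa [← hBsq, ← hμ]) t
  rw [← hBsq, ← hμ] at hb1 hb2
  have hind := h.indepFun hζ t
  have hσm := (h.memLp_volatility hζ t).1
  have hζp := hζ.memLp hp0 hint t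
  have hr : (fun ω => |r t ω| ^ p) =ᵐ[P] fun ω => |σ t ω * ζ t ω| ^ p := by
    filter_upwards [h.return_eq t] with ω hω
    rw [hω]
  have hden : 1 - C ^ (2 / p) * μ ^ (2 / p) * larchB β ^ 2 ≠ 0 := by linarith
  refine ⟨(integrable_congr hr).2 ((hind.memLp_mul hp0 ((memLp_ofReal_iff hp0 hσm).2 hσ)
    hζp).integrable_abs_rpow hp0), hσ, ?_, hb1.trans_eq ?_, hb2.trans_eq ?_⟩
  · rw [integral_congr_ae hr, hind.integral_abs_mul_rpow hσm hζp.1, hζ.integral_abs_rpow, hμ,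
      mul_comm]
  · rw [hC4]
    ring
  · field_simp
    ring
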